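/- Let $K$ be a non-Archimedean local field with residue field $\mathbb F_q$ and uniformizer $\pi$, and let $n, k, h \ge 1$ be integers with $\gcd(k,n)=1$. For an $\mathbb F_q$-algebra $A$ let $\mathbb W(A)$ be the ring of $\mathcal O_K$-Witt vectors of $A$ (formed with respect to $\pi$) if $\operatorname{char} K = 0$, and $\mathbb W(A) = A[\![\pi]\!]$ if $\operatorname{char} K > 0$; in both cases its elements are written in coordinates $[a_0,a_1,\dots]$. Let $\varphi([a_i]_{i\ge0}) = [a_i^q]_{i\ge0}$, $V([a_0,a_1,\dots]) = [0,a_0,a_1,\dots]$ and $\mathbb W_h(A) = \mathbb W(A)/V^h\mathbb W(A)$. Let $\sigma$ be the permutation of $\{1,\dots,n\}$ with $\sigma(i) \equiv i-k \pmod n$, and let $\tau\colon \{1,\dots,n\} \to \{0,\dots,n-1\}$ be the bijection with $\tau(1)=0$ and $\tau(\sigma(i)) \equiv \tau(i)-1 \pmod n$. For an $\mathbb F_{q^n}$-algebra $A$, let $X_h(A)$ be the set of families $(M_{(i,j,l)})$ of elements of $A$, indexed by $1\le i,j\le n$ and $1\le l\le h-1$, such that the following holds. Put $M_{i,i} = [1,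 M_{(i,i,1)},\dots,M_{(i,i,h-1)}]\in\mathbb W_h(A)$ for $1 \le i \le n$ and $M_{i,j} = [M_{(i,j,1)},\dots,M_{(i,j,h-1)}]\in\mathbb W_{h-1}(A)$ for $i\ne j$, and let $M$ be the matrix whose $(i,j)$ entry is $M_{i,j}$ for $i\le j$ and $\pi M_{i,j}$ for $i>j$. Then $$M_{i,\sigma^j(i)} = \varphi^{\tau(i)}\bigl(M_{1,\sigma^j(1)}\bigr)\quad (1\le i,j\le n), \qquad \varphi(\det M)=\det M \ \text{ in } \mathbb W_h(A).$$ Then the functor $A\mapsto X_h(A)$ on $\mathbb F_{q^n}$-algebras is represented by an affine scheme $X_h$ over $\mathbb F_{q^n}$, and $X_h$ is smooth over $\mathbb F_{q^n}$ of relative dimension $(n-1)(h-1)$; in particular, its Krull dimension is $(n-1)(h-1)$. -/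

import Mathlib

open CategoryTheory AlgebraicGeometry
open scoped ValuativeRel

universe u v w

/-! ## Ramified Witt vectors

`O` is a commutative ring, `ϖ` a non-zero-divisor of `O` and `q` a power of a prime `p` divisible by
`ϖ`, such that `a ^ q ≡ a` modulo `ϖ` for all `a` (for instance, the ring of integers of a local
field, a uniformizer, and the size of the residue field).  For every ring `A` under `O` the set
`ℕ → A` gets the unique functorial ring structure for which all the ghost maps
`x ↦ ∑ i ≤ m, ϖ ^ i * x i ^ (q ^ (m - i))` are ring homomorphisms. -/

namespace RamWitt

/-- Sequences of elements of `A`, without the pointwise ring structure. -/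
@[ext] structure Coords (A : Type v) : Type v where
  /-- The terms of the sequence. -/
  coeff : ℕ → A

/-- The hypotheses under which ramified Witt vectors are built. -/
structure IsBase {O : Type u} [CommRing O] (ϖ : O) (q : ℕ) : Prop where
  regular : ∀ a : O, ϖ * a = 0 → a = 0
  exists_prime : ∃ p f : ℕ, p.Prime ∧ q = p ^ f ∧ f ≠ 0 ∧ ϖ ∣ (p : O)
  pow_sub : ∀ a : O, ϖ ∣ a ^ q - a

section ghost

variable {O : Type u} [CommRing O] (ϖ : O) (q : ℕ)

/-- The `m`-th ghost component of `x`, in a ring `R` under `O`. -/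
def ghost {R : Type v} [CommRing R] (ρ : O →+* R) (x : ℕ → R) (m : ℕ) : R :=
  ∑ i ∈ Finset.range (m + 1), ρ ϖ ^ i * x i ^ (q ^ (m - i))

open Classical in
/-- The sequence with prescribed ghost components `g` (if it exists), over a polynomial ring. -/
noncomputable def unghost {σ : Type w} (g : ℕ → MvPolynomial σ O) (m : ℕ) : MvPolynomial σ O :=
  if H : (MvPolynomial.C ϖ : MvPolynomial σ O) ^ m ∣
      g m - ∑ i : Fin m, MvPolynomial.C ϖ ^ (i : ℕ) * unghost g i ^ (q ^ (m - i))
  then H.choose else 0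
termination_by m
decreasing_by exact i.2

/-- The polynomials giving the addition: their ghost components are
`ghost X m + ghost Y m`, with `X` and `Y` the two sequences of variables. -/
noncomputable def addPoly : ℕ → MvPolynomial (ℕ ⊕ ℕ) O :=
  unghost ϖ q fun m => ghost ϖ q MvPolynomial.C (fun i => MvPolynomial.X (Sum.inl i)) m +
    ghost ϖ q MvPolynomial.C (fun i => MvPolynomial.X (Sum.inr i)) m

/-- The polynomials giving the multiplication: their ghost components are
`ghost X m * ghost Y m`. -/
noncomputable def mulPoly : ℕ → MvPolynomial (ℕ ⊕ ℕ) O :=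
  unghost ϖ q fun m => ghost ϖ q MvPolynomial.C (fun i => MvPolynomial.X (Sum.inl i)) m *
    ghost ϖ q MvPolynomial.C (fun i => MvPolynomial.X (Sum.inr i)) m

/-- The polynomials giving the negation: their ghost components are `- ghost X m`. -/
noncomputable def negPoly : ℕ → MvPolynomial ℕ O :=
  unghost ϖ q fun m => - ghost ϖ q MvPolynomial.C (fun i => MvPolynomial.X i) m

variable {R : Type v} [CommRing R] (ρ : O →+* R)

/-- Addition of ramified Witt vectors. -/
noncomputable def add (x y : ℕ → R) : ℕ → R :=
  fun m => (addPoly ϖ q m).eval₂ ρ (Sum.elim x y)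

/-- Multiplication of ramified Witt vectors. -/
noncomputable def mul (x y : ℕ → R) : ℕ → R :=
  fun m => (mulPoly ϖ q m).eval₂ ρ (Sum.elim x y)

/-- Negation of ramified Witt vectors. -/
noncomputable def neg (x : ℕ → R) : ℕ → R :=
  fun m => (negPoly ϖ q m).eval₂ ρ x

/-- The unit `[1, 0, 0, …]`. -/
def one : ℕ → R := fun m => if m = 0 then 1 else 0

variable {S : Type w} [CommRing S]

theorem map_ghost (f : R →+* S) (x : ℕ → R) (m : ℕ) :
    f (ghost ϖ q ρ x m) = ghost ϖ q (f.comp ρ) (fun i => f (x i)) m := by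
  simp [ghost, map_sum]

theorem map_add (f : R →+* S) (x y : ℕ → R) :
    (fun i => f (add ϖ q ρ x y i)) = add ϖ q (f.comp ρ) (fun i => f (x i)) (fun i => f (y i)) := by
  funext m
  simp only [add]
  rw [MvPolynomial.hom_eval₂]
  congr 1
  funext i; cases i <;> rfl

theorem map_mul (f : R →+* S) (x y : ℕ → R) :
    (fun i => f (mul ϖ q ρ x y i)) = mul ϖ q (f.comp ρ) (fun i => f (x i)) (fun i => f (y i)) := by
  funext m
  simp only [mul]
  rw [MvPolynomial.hom_eval₂]
  congr 1
  funext i; cases i <;> rfl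

theorem map_neg (f : R →+* S) (x : ℕ → R) :
    (fun i => f (neg ϖ q ρ x i)) = neg ϖ q (f.comp ρ) (fun i => f (x i)) := by
  funext m
  simp only [neg]
  rw [MvPolynomial.hom_eval₂]

variable {ϖ q}

theorem IsBase.q_pos (B : IsBase ϖ q) : 0 < q := by
  obtain ⟨p, f, hp, rfl, -⟩ := B.exists_prime
  exact pow_pos hp.pos f

theorem IsBase.dvd_q (B : IsBase ϖ q) : ϖ ∣ (q : O) := by
  obtain ⟨p, f, hp, rfl, hf, h⟩ := B.exists_prime
  push_cast
  exact h.trans (dvd_pow_self _ hf)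

theorem pow_congr {t : R} (ht : t ∣ (q : R)) {a b : R} {m : ℕ} (h : t ^ (m + 1) ∣ a - b) :
    t ^ (m + 2) ∣ a ^ q - b ^ q := by
  have h1 : t ∣ a - b := (dvd_pow_self t (Nat.succ_ne_zero m)).trans h
  rw [← (Commute.all a b).geom_sum₂_mul, mul_comm, pow_succ]
  refine mul_dvd_mul h ?_
  have key : ∀ i ∈ Finset.range q, t ∣ a ^ i * b ^ (q - 1 - i) - b ^ (q - 1) := by
    intro i hi
    have : b ^ (q - 1) = b ^ i * b ^ (q - 1 - i) := by
      rw [← pow_add]; congr 1; have := Finset.mem_range.1 hi; omega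
    rw [this, ← sub_mul]
    exact (h1.trans (sub_dvd_pow_sub_pow a b i)).mul_right _
  have h2 := Finset.dvd_sum key
  rw [Finset.sum_sub_distrib, Finset.sum_const, Finset.card_range, nsmul_eq_mul] at h2
  exact (dvd_sub_left (ht.mul_right _)).1 h2

theorem pow_pow_congr {t : R} (ht : t ∣ (q : R)) {a b : R} (h : t ∣ a - b) (m : ℕ) :
    t ^ (m + 1) ∣ a ^ q ^ m - b ^ q ^ m := by
  induction m with
  | zero => simpa using h
  | succ m ih =>
    rw [pow_succ q, pow_mul, pow_mul]
    exact pow_congr ht ih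

theorem dvd_expand_sub (B : IsBase ϖ q) {σ : Type w} (f : MvPolynomial σ O) :
    MvPolynomial.C ϖ ∣ MvPolynomial.expand q f - f ^ q := by
  induction f using MvPolynomial.induction_on with
  | C a =>
    have := (MvPolynomial.C (σ := σ)).map_dvd (B.pow_sub a)
    rw [← dvd_neg]
    simpa using this
  | add f g hf hg =>
    obtain ⟨p, e, hp, rfl, he, hd⟩ := B.exists_prime
    obtain ⟨r, hr⟩ := exists_add_pow_prime_pow_eq hp f g e
    have h3 : (MvPolynomial.C ϖ : MvPolynomial σ O) ∣ (p : MvPolynomial σ O) := by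
      simpa using (MvPolynomial.C (σ := σ)).map_dvd hd
    rw [hr, _root_.map_add]
    have h4 : (MvPolynomial.C ϖ : MvPolynomial σ O) ∣ p * f * g * r := by
      rw [mul_assoc, mul_assoc]; exact h3.mul_right _
    have := dvd_sub (dvd_add hf hg) h4
    convert this using 1
    ring
  | mul_X f i hf =>
    rw [_root_.map_mul, MvPolynomial.expand_X, mul_pow, ← sub_mul]
    exact hf.mul_right _

theorem ghost_unghost (B : IsBase ϖ q) {σ : Type w} (g : ℕ → MvPolynomial σ O)
    (hg : ∀ m, MvPolynomial.C ϖ ^ (m + 1) ∣ g (m + 1) - MvPolynomial.expand q (g m)) (m : ℕ) :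
    ghost ϖ q MvPolynomial.C (unghost ϖ q g) m = g m := by
  have hC : (MvPolynomial.C ϖ : MvPolynomial σ O) ∣ (q : MvPolynomial σ O) := by
    simpa using (MvPolynomial.C (σ := σ)).map_dvd B.dvd_q
  have key : (MvPolynomial.C ϖ : MvPolynomial σ O) ^ m ∣ g m -
      ∑ i : Fin m, MvPolynomial.C ϖ ^ (i : ℕ) * unghost ϖ q g i ^ (q ^ (m - i)) := by
    cases m with
    | zero => simp
    | succ m =>
      have ih := ghost_unghost B g hg m
      have h1 := hg m
      rw [← ih] at h1
      rw [Fin.sum_univ_eq_sum_range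
        (fun i => MvPolynomial.C ϖ ^ i * unghost ϖ q g i ^ (q ^ (m + 1 - i))) (m + 1)]
      refine (dvd_iff_dvd_of_dvd_sub ?_).1 h1
      rw [sub_sub_sub_cancel_left, ghost, _root_.map_sum, ← Finset.sum_sub_distrib, ← dvd_neg,
        ← Finset.sum_neg_distrib]
      refine Finset.dvd_sum fun i hi => ?_
      have hi' : i ≤ m := Nat.lt_succ_iff.1 (Finset.mem_range.1 hi)
      have h2 := pow_pow_congr hC (dvd_expand_sub B (unghost ϖ q g i)) (m - i)
      have h3 : m + 1 - i = (m - i) + 1 := by omega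
      rw [h3, pow_succ' q, pow_mul, _root_.map_mul, _root_.map_pow, _root_.map_pow,
        MvPolynomial.expand_C, ← mul_sub, ← mul_neg]
      have h4 : m + 1 = i + (m - i + 1) := by omega
      rw [h4, pow_add]
      refine mul_dvd_mul_left _ ?_
      rw [neg_sub]
      exact h2
  rw [ghost, Finset.sum_range_succ, ← Fin.sum_univ_eq_sum_range
    (fun i => MvPolynomial.C ϖ ^ i * unghost ϖ q g i ^ (q ^ (m - i))) m]
  have h5 : unghost ϖ q g m = key.choose := by
    rw [unghost, dif_pos key]
  have h6 := key.choose_spec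
  rw [← h5] at h6
  rw [Nat.sub_self, pow_zero, pow_one, ← h6]
  ring

theorem dvd_ghost_sub {σ : Type w} (e : ℕ → σ) (m : ℕ) :
    (MvPolynomial.C ϖ : MvPolynomial σ O) ^ (m + 1) ∣
      ghost ϖ q MvPolynomial.C (fun i => MvPolynomial.X (e i)) (m + 1) -
        MvPolynomial.expand q (ghost ϖ q MvPolynomial.C (fun i => MvPolynomial.X (e i)) m) := by
  have : MvPolynomial.expand q
      (ghost ϖ q MvPolynomial.C (fun i => (MvPolynomial.X (e i) : MvPolynomial σ O)) m) =
      ∑ i ∈ Finset.range (m + 1), MvPolynomial.C ϖ ^ i * MvPolynomial.X (e i) ^ q ^ (m + 1 - i) := by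
    rw [ghost, map_sum]
    refine Finset.sum_congr rfl fun i hi => ?_
    have h3 : m + 1 - i = (m - i) + 1 := by have := Finset.mem_range.1 hi; omega
    rw [h3, pow_succ' q, pow_mul]
    simp
  rw [this, ghost, Finset.sum_range_succ, add_sub_cancel_left]
  exact dvd_mul_right _ _

theorem ghost_addPoly (B : IsBase ϖ q) (m : ℕ) : ghost ϖ q MvPolynomial.C (addPoly ϖ q) m =
    ghost ϖ q MvPolynomial.C (fun i => MvPolynomial.X (Sum.inl i)) m +
    ghost ϖ q MvPolynomial.C (fun i => MvPolynomial.X (Sum.inr i)) m := by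
  refine ghost_unghost B _ (fun m => ?_) m
  have := dvd_add (dvd_ghost_sub (ϖ := ϖ) (q := q) (Sum.inl : ℕ → ℕ ⊕ ℕ) m)
    (dvd_ghost_sub (ϖ := ϖ) (q := q) Sum.inr m)
  rw [_root_.map_add]
  convert this using 1
  ring

theorem ghost_mulPoly (B : IsBase ϖ q) (m : ℕ) : ghost ϖ q MvPolynomial.C (mulPoly ϖ q) m =
    ghost ϖ q MvPolynomial.C (fun i => MvPolynomial.X (Sum.inl i)) m *
    ghost ϖ q MvPolynomial.C (fun i => MvPolynomial.X (Sum.inr i)) m := by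
  refine ghost_unghost B _ (fun m => ?_) m
  have h1 := dvd_ghost_sub (ϖ := ϖ) (q := q) (Sum.inl : ℕ → ℕ ⊕ ℕ) m
  have h2 := dvd_ghost_sub (ϖ := ϖ) (q := q) (Sum.inr : ℕ → ℕ ⊕ ℕ) m
  rw [_root_.map_mul]
  have := dvd_add (h1.mul_right
    (ghost ϖ q MvPolynomial.C (fun i => MvPolynomial.X (Sum.inr i : ℕ ⊕ ℕ)) (m + 1)))
    (h2.mul_left (MvPolynomial.expand q
      (ghost ϖ q MvPolynomial.C (fun i => MvPolynomial.X (Sum.inl i : ℕ ⊕ ℕ)) m)))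
  convert this using 1
  ring

theorem ghost_negPoly (B : IsBase ϖ q) (m : ℕ) : ghost ϖ q MvPolynomial.C (negPoly ϖ q) m =
    - ghost ϖ q MvPolynomial.C (fun i => MvPolynomial.X i) m := by
  refine ghost_unghost B _ (fun m => ?_) m
  have := (dvd_neg).2 (dvd_ghost_sub (ϖ := ϖ) (q := q) (id : ℕ → ℕ) m)
  rw [_root_.map_neg]
  convert this using 1
  simp only [id]
  ring

theorem ghost_add (B : IsBase ϖ q) (x y : ℕ → R) (m : ℕ) :
    ghost ϖ q ρ (add ϖ q ρ x y) m = ghost ϖ q ρ x m + ghost ϖ q ρ y m := by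
  have := congrArg (MvPolynomial.eval₂Hom ρ (Sum.elim x y)) (ghost_addPoly B m)
  rw [_root_.map_add, map_ghost, map_ghost, map_ghost, MvPolynomial.eval₂Hom_comp_C] at this
  simp only [MvPolynomial.coe_eval₂Hom, MvPolynomial.eval₂_X, Sum.elim_inl, Sum.elim_inr] at this
  exact this

theorem ghost_mul (B : IsBase ϖ q) (x y : ℕ → R) (m : ℕ) :
    ghost ϖ q ρ (mul ϖ q ρ x y) m = ghost ϖ q ρ x m * ghost ϖ q ρ y m := by
  have := congrArg (MvPolynomial.eval₂Hom ρ (Sum.elim x y)) (ghost_mulPoly B m)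
  rw [_root_.map_mul, map_ghost, map_ghost, map_ghost, MvPolynomial.eval₂Hom_comp_C] at this
  simp only [MvPolynomial.coe_eval₂Hom, MvPolynomial.eval₂_X, Sum.elim_inl, Sum.elim_inr] at this
  exact this

theorem ghost_neg (B : IsBase ϖ q) (x : ℕ → R) (m : ℕ) :
    ghost ϖ q ρ (neg ϖ q ρ x) m = - ghost ϖ q ρ x m := by
  have := congrArg (MvPolynomial.eval₂Hom ρ x) (ghost_negPoly B m)
  rw [_root_.map_neg, map_ghost, map_ghost, MvPolynomial.eval₂Hom_comp_C] at this
  simp only [MvPolynomial.coe_eval₂Hom, MvPolynomial.eval₂_X] at this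
  exact this

theorem ghost_zero (B : IsBase ϖ q) (m : ℕ) : ghost ϖ q ρ (fun _ => (0 : R)) m = 0 := by
  refine Finset.sum_eq_zero fun i _ => ?_
  rw [zero_pow (pow_pos B.q_pos _).ne', mul_zero]

theorem ghost_one (B : IsBase ϖ q) (m : ℕ) : ghost ϖ q ρ (one : ℕ → R) m = 1 := by
  rw [ghost, Finset.sum_eq_single 0]
  · simp [one]
  · intro i _ hi
    rw [one, if_neg hi, zero_pow (pow_pos B.q_pos _).ne', mul_zero]
  · simp

/-- Over a polynomial ring, the first `h` ghost components determine the first `h` components. -/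
theorem ext_of_ghost (B : IsBase ϖ q) {σ : Type w} {h : ℕ} {x y : ℕ → MvPolynomial σ O}
    (H : ∀ m < h, ghost ϖ q MvPolynomial.C x m = ghost ϖ q MvPolynomial.C y m) :
    ∀ m < h, x m = y m := by
  have hreg : ∀ (m : ℕ) (f : MvPolynomial σ O), MvPolynomial.C ϖ ^ m * f = 0 → f = 0 := by
    intro m
    induction m with
    | zero => intro f hf; simpa using hf
    | succ m ih =>
      intro f hf
      rw [pow_succ, mul_assoc] at hf
      have h1 := ih _ hf
      ext d
      have h2 := congrArg (MvPolynomial.coeff d) h1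
      rw [MvPolynomial.coeff_C_mul, MvPolynomial.coeff_zero] at h2
      rw [MvPolynomial.coeff_zero]
      exact B.regular _ h2
  intro m
  induction m using Nat.strong_induction_on with
  | _ m ih =>
    intro hm
    have h1 := H m hm
    have h2 : ∀ i ∈ Finset.range m, (MvPolynomial.C ϖ : MvPolynomial σ O) ^ i *
        x i ^ q ^ (m - i) = MvPolynomial.C ϖ ^ i * y i ^ q ^ (m - i) := by
      intro i hi
      have hi' := Finset.mem_range.1 hi
      rw [ih i hi' (hi'.trans hm)]
    rw [ghost, ghost, Finset.sum_range_succ, Finset.sum_range_succ, Finset.sum_congr rfl h2,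
      add_right_inj, Nat.sub_self, pow_zero, pow_one, pow_one, ← sub_eq_zero, ← mul_sub] at h1
    exact sub_eq_zero.1 (hreg m _ h1)

theorem eq_of_ghost (B : IsBase ϖ q) {σ : Type w} {x y : ℕ → MvPolynomial σ O}
    (H : ∀ m, ghost ϖ q MvPolynomial.C x m = ghost ϖ q MvPolynomial.C y m) : x = y :=
  funext fun m => ext_of_ghost B (h := m + 1) (fun i _ => H i) m (Nat.lt_succ_self m)

/-- The polynomial ring on the elements of `R` maps onto `R`. -/
noncomputable def toRing : MvPolynomial R O →+* R := MvPolynomial.eval₂Hom ρ id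

theorem toRing_comp : (toRing ρ).comp MvPolynomial.C = ρ := MvPolynomial.eval₂Hom_comp_C _ _

theorem exists_lift (x : ℕ → R) :
    ∃ x' : ℕ → MvPolynomial R O, (fun i => toRing ρ (x' i)) = x :=
  ⟨fun i => MvPolynomial.X (x i), by funext i; simp [toRing]⟩

theorem toRing_add (x y : ℕ → MvPolynomial R O) :
    add ϖ q ρ (fun i => toRing ρ (x i)) (fun i => toRing ρ (y i)) =
      fun i => toRing ρ (add ϖ q MvPolynomial.C x y i) := by
  rw [map_add, toRing_comp]

theorem toRing_mul (x y : ℕ → MvPolynomial R O) :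
    mul ϖ q ρ (fun i => toRing ρ (x i)) (fun i => toRing ρ (y i)) =
      fun i => toRing ρ (mul ϖ q MvPolynomial.C x y i) := by
  rw [map_mul, toRing_comp]

theorem toRing_neg (x : ℕ → MvPolynomial R O) :
    neg ϖ q ρ (fun i => toRing ρ (x i)) =
      fun i => toRing ρ (neg ϖ q MvPolynomial.C x i) := by
  rw [map_neg, toRing_comp]

theorem toRing_one : (one : ℕ → R) = fun i => toRing ρ ((one : ℕ → MvPolynomial R O) i) := by
  funext i
  by_cases h : i = 0 <;> simp [one, h]

theorem toRing_zero : (fun _ => 0 : ℕ → R) = fun _ => toRing ρ 0 := by simp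

theorem congr_toRing (B : IsBase ϖ q) {x y : ℕ → MvPolynomial R O}
    (H : ∀ m, ghost ϖ q MvPolynomial.C x m = ghost ϖ q MvPolynomial.C y m) :
    (fun i => toRing ρ (x i)) = fun i => toRing ρ (y i) := by
  rw [eq_of_ghost B H]

/-- The ring of ramified Witt vectors over a ring `R` under `O`. -/
@[reducible] noncomputable def commRing (B : IsBase ϖ q) : CommRing (Coords R) where
  add x y := ⟨add ϖ q ρ x.coeff y.coeff⟩
  mul x y := ⟨mul ϖ q ρ x.coeff y.coeff⟩
  neg x := ⟨neg ϖ q ρ x.coeff⟩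
  zero := ⟨fun _ => 0⟩
  one := ⟨one⟩
  nsmul := @nsmulRec _ ⟨⟨fun _ => 0⟩⟩ ⟨fun x y => ⟨add ϖ q ρ x.coeff y.coeff⟩⟩
  zsmul := @zsmulRec _ ⟨⟨fun _ => 0⟩⟩ ⟨fun x y => ⟨add ϖ q ρ x.coeff y.coeff⟩⟩
    ⟨fun x => ⟨neg ϖ q ρ x.coeff⟩⟩
    (@nsmulRec _ ⟨⟨fun _ => 0⟩⟩ ⟨fun x y => ⟨add ϖ q ρ x.coeff y.coeff⟩⟩)
  add_assoc x y z := by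
    refine Coords.ext ?_
    change add ϖ q ρ (add ϖ q ρ x.coeff y.coeff) z.coeff = add ϖ q ρ x.coeff (add ϖ q ρ y.coeff z.coeff)
    obtain ⟨x', hx⟩ := exists_lift ρ x.coeff
    obtain ⟨y', hy⟩ := exists_lift ρ y.coeff
    obtain ⟨z', hz⟩ := exists_lift ρ z.coeff
    simp only [← hx, ← hy, ← hz, toRing_add]
    exact congr_toRing ρ B fun m => by simp only [ghost_add _ B, add_assoc]
  add_comm x y := by
    refine Coords.ext ?_
    change add ϖ q ρ x.coeff y.coeff = add ϖ q ρ y.coeff x.coeff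
    obtain ⟨x', hx⟩ := exists_lift ρ x.coeff
    obtain ⟨y', hy⟩ := exists_lift ρ y.coeff
    simp only [← hx, ← hy, toRing_add]
    exact congr_toRing ρ B fun m => by simp only [ghost_add _ B, add_comm]
  zero_add x := by
    refine Coords.ext ?_
    change add ϖ q ρ (fun _ => 0) x.coeff = x.coeff
    obtain ⟨x', hx⟩ := exists_lift ρ x.coeff
    simp only [← hx, toRing_zero ρ, toRing_add]
    exact congr_toRing ρ B fun m => by simp only [ghost_add _ B, ghost_zero _ B, zero_add]
  add_zero x := by
    refine Coords.ext ?_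
    change add ϖ q ρ x.coeff (fun _ => 0) = x.coeff
    obtain ⟨x', hx⟩ := exists_lift ρ x.coeff
    simp only [← hx, toRing_zero ρ, toRing_add]
    exact congr_toRing ρ B fun m => by simp only [ghost_add _ B, ghost_zero _ B, add_zero]
  neg_add_cancel x := by
    refine Coords.ext ?_
    change add ϖ q ρ (neg ϖ q ρ x.coeff) x.coeff = fun _ => 0
    obtain ⟨x', hx⟩ := exists_lift ρ x.coeff
    simp only [← hx, toRing_zero ρ, toRing_add, toRing_neg]
    exact congr_toRing ρ B fun m => by simp only [ghost_add _ B, ghost_neg _ B, ghost_zero _ B, neg_add_cancel]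
  mul_assoc x y z := by
    refine Coords.ext ?_
    change mul ϖ q ρ (mul ϖ q ρ x.coeff y.coeff) z.coeff = mul ϖ q ρ x.coeff (mul ϖ q ρ y.coeff z.coeff)
    obtain ⟨x', hx⟩ := exists_lift ρ x.coeff
    obtain ⟨y', hy⟩ := exists_lift ρ y.coeff
    obtain ⟨z', hz⟩ := exists_lift ρ z.coeff
    simp only [← hx, ← hy, ← hz, toRing_mul]
    exact congr_toRing ρ B fun m => by simp only [ghost_mul _ B, mul_assoc]
  mul_comm x y := by
    refine Coords.ext ?_
    change mul ϖ q ρ x.coeff y.coeff = mul ϖ q ρ y.coeff x.coeff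
    obtain ⟨x', hx⟩ := exists_lift ρ x.coeff
    obtain ⟨y', hy⟩ := exists_lift ρ y.coeff
    simp only [← hx, ← hy, toRing_mul]
    exact congr_toRing ρ B fun m => by simp only [ghost_mul _ B, mul_comm]
  one_mul x := by
    refine Coords.ext ?_
    change mul ϖ q ρ one x.coeff = x.coeff
    obtain ⟨x', hx⟩ := exists_lift ρ x.coeff
    simp only [← hx, toRing_one ρ, toRing_mul]
    exact congr_toRing ρ B fun m => by simp only [ghost_mul _ B, ghost_one _ B, one_mul]
  mul_one x := by
    refine Coords.ext ?_
    change mul ϖ q ρ x.coeff one = x.coeff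
    obtain ⟨x', hx⟩ := exists_lift ρ x.coeff
    simp only [← hx, toRing_one ρ, toRing_mul]
    exact congr_toRing ρ B fun m => by simp only [ghost_mul _ B, ghost_one _ B, mul_one]
  zero_mul x := by
    refine Coords.ext ?_
    change mul ϖ q ρ (fun _ => 0) x.coeff = fun _ => 0
    obtain ⟨x', hx⟩ := exists_lift ρ x.coeff
    simp only [← hx, toRing_zero ρ, toRing_mul]
    exact congr_toRing ρ B fun m => by simp only [ghost_mul _ B, ghost_zero _ B, zero_mul]
  mul_zero x := by
    refine Coords.ext ?_
    change mul ϖ q ρ x.coeff (fun _ => 0) = fun _ => 0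
    obtain ⟨x', hx⟩ := exists_lift ρ x.coeff
    simp only [← hx, toRing_zero ρ, toRing_mul]
    exact congr_toRing ρ B fun m => by simp only [ghost_mul _ B, ghost_zero _ B, mul_zero]
  left_distrib x y z := by
    refine Coords.ext ?_
    change mul ϖ q ρ x.coeff (add ϖ q ρ y.coeff z.coeff) = add ϖ q ρ (mul ϖ q ρ x.coeff y.coeff) (mul ϖ q ρ x.coeff z.coeff)
    obtain ⟨x', hx⟩ := exists_lift ρ x.coeff
    obtain ⟨y', hy⟩ := exists_lift ρ y.coeff
    obtain ⟨z', hz⟩ := exists_lift ρ z.coeff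
    simp only [← hx, ← hy, ← hz, toRing_add, toRing_mul]
    exact congr_toRing ρ B fun m => by simp only [ghost_mul _ B, ghost_add _ B, mul_add]
  right_distrib x y z := by
    refine Coords.ext ?_
    change mul ϖ q ρ (add ϖ q ρ x.coeff y.coeff) z.coeff = add ϖ q ρ (mul ϖ q ρ x.coeff z.coeff) (mul ϖ q ρ y.coeff z.coeff)
    obtain ⟨x', hx⟩ := exists_lift ρ x.coeff
    obtain ⟨y', hy⟩ := exists_lift ρ y.coeff
    obtain ⟨z', hz⟩ := exists_lift ρ z.coeff
    simp only [← hx, ← hy, ← hz, toRing_add, toRing_mul]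
    exact congr_toRing ρ B fun m => by simp only [ghost_mul _ B, ghost_add _ B, add_mul]

theorem exists_lift_zero {h : ℕ} {x : ℕ → R} (hx : ∀ i < h, x i = 0) :
    ∃ x' : ℕ → MvPolynomial R O, (fun i => toRing ρ (x' i)) = x ∧ ∀ i < h, x' i = 0 := by
  refine ⟨fun i => if i < h then 0 else MvPolynomial.X (x i), ?_, fun i hi => if_pos hi⟩
  funext i
  by_cases hi : i < h <;> simp [hi, toRing, hx]

theorem ghost_eq_zero (B : IsBase ϖ q) {h : ℕ} {x : ℕ → R} (hx : ∀ i < h, x i = 0) :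
    ∀ m < h, ghost ϖ q ρ x m = 0 := by
  intro m hm
  refine Finset.sum_eq_zero fun i hi => ?_
  rw [hx i ((Nat.lt_succ_iff.1 (Finset.mem_range.1 hi)).trans_lt hm),
    zero_pow (pow_pos B.q_pos _).ne', mul_zero]

theorem add_lt (B : IsBase ϖ q) {h : ℕ} {x y : ℕ → R} (hx : ∀ i < h, x i = 0)
    (hy : ∀ i < h, y i = 0) : ∀ i < h, add ϖ q ρ x y i = 0 := by
  obtain ⟨x, rfl, hx'⟩ := exists_lift_zero ρ hx
  obtain ⟨y, rfl, hy'⟩ := exists_lift_zero ρ hy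
  intro i hi
  rw [toRing_add]
  have : add ϖ q MvPolynomial.C x y i = 0 :=
    ext_of_ghost B (h := h) (y := fun _ => 0) (fun m hm => by
      rw [ghost_add _ B, ghost_zero _ B, ghost_eq_zero _ B hx' m hm, ghost_eq_zero _ B hy' m hm,
        add_zero]) i hi
  simp [this]

theorem mul_lt (B : IsBase ϖ q) {h : ℕ} (x : ℕ → R) {y : ℕ → R}
    (hy : ∀ i < h, y i = 0) : ∀ i < h, mul ϖ q ρ x y i = 0 := by
  obtain ⟨x, rfl⟩ := exists_lift ρ x
  obtain ⟨y, rfl, hy'⟩ := exists_lift_zero ρ hy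
  intro i hi
  rw [toRing_mul]
  have : mul ϖ q MvPolynomial.C x y i = 0 :=
    ext_of_ghost B (h := h) (y := fun _ => 0) (fun m hm => by
      rw [ghost_mul _ B, ghost_zero _ B, ghost_eq_zero _ B hy' m hm, mul_zero]) i hi
  simp [this]

end ghost

end RamWitt

/-! ## The rings `𝕎(A)` and `𝕎_h(A)` of a local field -/

section OWitt

variable (K : Type u) [Field K] [ValuativeRel K] [TopologicalSpace K] [IsNonarchimedeanLocalField K]

/-- The uniformizers of the local field `K`. -/
structure Uniformizer : Type u where
  /-- The underlying element of the ring of integers. -/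
  val : 𝒪[K]
  irreducible : Irreducible val

variable {K}

theorem Uniformizer.isBase (ϖ : Uniformizer K) : RamWitt.IsBase ϖ.val (Nat.card 𝓀[K]) := by
  have := Fintype.ofFinite 𝓀[K]
  have hmem : ∀ a : 𝒪[K], IsLocalRing.residue 𝒪[K] a = 0 → ϖ.val ∣ a := fun a ha => by
    rw [IsLocalRing.residue_eq_zero_iff, ϖ.irreducible.maximalIdeal_eq, Ideal.mem_span_singleton] at ha
    exact ha
  refine ⟨fun a ha => (mul_eq_zero.1 ha).resolve_left ϖ.irreducible.ne_zero, ?_, fun a => hmem _ ?_⟩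
  · obtain ⟨p, hp⟩ := CharP.exists 𝓀[K]
    obtain ⟨f, hp', hf⟩ := FiniteField.card 𝓀[K] p
    refine ⟨p, f, hp', by rw [Nat.card_eq_fintype_card, hf], f.pos.ne', hmem _ ?_⟩
    rw [map_natCast, CharP.cast_eq_zero]
  · rw [map_sub, map_pow, Nat.card_eq_fintype_card, FiniteField.pow_card, sub_self]

/-- The underlying set of `𝕎(A)`: an element is given by its coordinates `[a₀, a₁, a₂, …]`. -/
@[ext] structure OWitt (ϖ : Uniformizer K) (A : Type v) : Type v where
  /-- The coordinates. -/
  coeff : ℕ → A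

namespace OWitt

section ring

variable (ϖ : Uniformizer K) (A : Type v) [CommRing A]

/-- The bijection of `𝕎(A)` with the set of sequences in `A`. -/
def equivCoords : OWitt ϖ A ≃ RamWitt.Coords A :=
  ⟨fun x => ⟨x.coeff⟩, fun x => ⟨x.coeff⟩, fun _ => rfl, fun _ => rfl⟩

/-- The bijection of `𝕎(A)` with `A⟦π⟧` that sends `[a₀, a₁, …]` to `∑ aᵢ πⁱ`. -/
noncomputable def equivPowerSeries : OWitt ϖ A ≃ PowerSeries A :=
  ⟨fun x => PowerSeries.mk x.coeff, fun f => ⟨fun m => PowerSeries.coeff m f⟩,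
    fun x => OWitt.ext (funext fun m => PowerSeries.coeff_mk m x.coeff),
    fun _ => PowerSeries.ext fun m => PowerSeries.coeff_mk m _⟩

variable [Algebra 𝓀[K] A]

/-- The structure map of an algebra over the residue field, seen as an algebra over `𝒪[K]`. -/
noncomputable def structureMap (K : Type u) [Field K] [ValuativeRel K] [TopologicalSpace K]
    [IsNonarchimedeanLocalField K] (A : Type v) [CommRing A] [Algebra 𝓀[K] A] : 𝒪[K] →+* A :=
  (algebraMap 𝓀[K] A).comp (IsLocalRing.residue 𝒪[K])

/-- The ring of `𝒪[K]`-Witt vectors over `A`. -/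
@[reducible] noncomputable def mixedCommRing : CommRing (OWitt ϖ A) :=
  letI := RamWitt.commRing (structureMap K A) ϖ.isBase
  (equivCoords ϖ A).commRing

/-- The ring `A⟦π⟧`. -/
@[reducible] noncomputable def equalCommRing (A : Type v) [CommRing A] : CommRing (OWitt ϖ A) :=
  (equivPowerSeries ϖ A).commRing

open Classical in
/-- The ring `𝕎(A)`, for an algebra `A` over the residue field of `K`: the ring of `𝒪[K]`-Witt
vectors if `K` has characteristic `0`, and the ring `A⟦π⟧` of power series otherwise. -/
noncomputable instance instCommRing : CommRing (OWitt ϖ A) :=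
  if CharZero K then mixedCommRing ϖ A else equalCommRing ϖ A

theorem instCommRing_of_charZero (hK : CharZero K) : instCommRing ϖ A = mixedCommRing ϖ A :=
  if_pos hK

theorem instCommRing_of_not_charZero (hK : ¬ CharZero K) :
    instCommRing ϖ A = equalCommRing ϖ A :=
  if_neg hK

end ring

variable {ϖ : Uniformizer K} {A : Type v} [CommRing A]

/-- The Frobenius `φ : [aᵢ] ↦ [aᵢ ^ q]`. -/
noncomputable def frob (x : OWitt ϖ A) : OWitt ϖ A := ⟨fun i => x.coeff i ^ Nat.card 𝓀[K]⟩

/-- The Verschiebung `V : [a₀, a₁, …] ↦ [0, a₀, a₁, …]`. -/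
def versch (x : OWitt ϖ A) : OWitt ϖ A := ⟨fun i => if i = 0 then 0 else x.coeff (i - 1)⟩

variable [Algebra 𝓀[K] A]

variable (ϖ A) in
/-- The image of the uniformizer `π` in `𝕎(A)`, which is `V(1) = [0, 1, 0, 0, …]`. -/
noncomputable def unif : OWitt ϖ A := versch 1

theorem zero_coeff (m : ℕ) : (0 : OWitt ϖ A).coeff m = 0 := by
  by_cases hK : CharZero K
  · exact congrArg (fun I : CommRing (OWitt ϖ A) => I.zero.coeff m)
      (instCommRing_of_charZero ϖ A hK)
  · exact (congrArg (fun I : CommRing (OWitt ϖ A) => I.zero.coeff m)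
      (instCommRing_of_not_charZero ϖ A hK)).trans (map_zero (PowerSeries.coeff (R := A) m))

theorem one_coeff (m : ℕ) : (1 : OWitt ϖ A).coeff m = if m = 0 then 1 else 0 := by
  by_cases hK : CharZero K
  · exact congrArg (fun I : CommRing (OWitt ϖ A) => I.one.coeff m)
      (instCommRing_of_charZero ϖ A hK)
  · exact (congrArg (fun I : CommRing (OWitt ϖ A) => I.one.coeff m)
      (instCommRing_of_not_charZero ϖ A hK)).trans (PowerSeries.coeff_one (R := A) m)

theorem add_coeff_of_charZero (hK : CharZero K) (x y : OWitt ϖ A) : (x + y).coeff =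
    RamWitt.add ϖ.val (Nat.card 𝓀[K]) (structureMap K A) x.coeff y.coeff :=
  congrArg (fun I : CommRing (OWitt ϖ A) => (I.add x y).coeff) (instCommRing_of_charZero ϖ A hK)

theorem mul_coeff_of_charZero (hK : CharZero K) (x y : OWitt ϖ A) : (x * y).coeff =
    RamWitt.mul ϖ.val (Nat.card 𝓀[K]) (structureMap K A) x.coeff y.coeff :=
  congrArg (fun I : CommRing (OWitt ϖ A) => (I.mul x y).coeff) (instCommRing_of_charZero ϖ A hK)

theorem add_coeff_of_not_charZero (hK : ¬ CharZero K) (x y : OWitt ϖ A) (m : ℕ) :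
    (x + y).coeff m = x.coeff m + y.coeff m := by
  refine (congrArg (fun I : CommRing (OWitt ϖ A) => (I.add x y).coeff m)
    (instCommRing_of_not_charZero ϖ A hK)).trans ?_
  change PowerSeries.coeff m (PowerSeries.mk x.coeff + PowerSeries.mk y.coeff) = _
  rw [map_add, PowerSeries.coeff_mk, PowerSeries.coeff_mk]

theorem mul_coeff_of_not_charZero (hK : ¬ CharZero K) (x y : OWitt ϖ A) (m : ℕ) :
    (x * y).coeff m = ∑ p ∈ Finset.HasAntidiagonal.antidiagonal m, x.coeff p.1 * y.coeff p.2 := by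
  refine (congrArg (fun I : CommRing (OWitt ϖ A) => (I.mul x y).coeff m)
    (instCommRing_of_not_charZero ϖ A hK)).trans ?_
  change PowerSeries.coeff m (PowerSeries.mk x.coeff * PowerSeries.mk y.coeff) = _
  simp only [PowerSeries.coeff_mul, PowerSeries.coeff_mk]

theorem unif_coeff (m : ℕ) : (unif ϖ A).coeff m = if m = 1 then 1 else 0 := by
  rcases m with _ | _ | m <;> simp [unif, versch, one_coeff]

variable (ϖ A) in
/-- The ideal `V ^ h 𝕎(A)`: the elements whose first `h` coordinates vanish. -/
def fil (h : ℕ) : Ideal (OWitt ϖ A) where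
  carrier := {x | ∀ i < h, x.coeff i = 0}
  zero_mem' i _ := zero_coeff i
  add_mem' {x y} hx hy := by
    change ∀ i < h, (x + y).coeff i = 0
    by_cases hK : CharZero K
    · rw [add_coeff_of_charZero hK]
      exact RamWitt.add_lt _ ϖ.isBase hx hy
    · intro i hi
      rw [add_coeff_of_not_charZero hK, hx i hi, hy i hi, add_zero]
  smul_mem' x y hy := by
    change ∀ i < h, (x * y).coeff i = 0
    by_cases hK : CharZero K
    · rw [mul_coeff_of_charZero hK]
      exact RamWitt.mul_lt _ ϖ.isBase x.coeff hy
    · intro i hi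
      rw [mul_coeff_of_not_charZero hK]
      refine Finset.sum_eq_zero fun p hp => ?_
      have hp' := Finset.HasAntidiagonal.mem_antidiagonal.1 hp
      rw [hy p.2 (by omega), mul_zero]

theorem mem_fil_iff_coeff {h : ℕ} {x : OWitt ϖ A} : x ∈ fil ϖ A h ↔ ∀ i < h, x.coeff i = 0 :=
  Iff.rfl

theorem mem_fil_iff (h : ℕ) (x : OWitt ϖ A) : x ∈ fil ϖ A h ↔ ∃ y, x = versch^[h] y := by
  have key : ∀ (h : ℕ) (y : OWitt ϖ A) (i : ℕ),
      (versch^[h] y).coeff i = if h ≤ i then y.coeff (i - h) else 0 := by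
    intro h
    induction h with
    | zero => intro y i; simp
    | succ h ih =>
      intro y i
      rw [Function.iterate_succ_apply', versch]
      cases i with
      | zero => simp
      | succ i => simp [ih]
  rw [mem_fil_iff_coeff]
  constructor
  · intro hx
    refine ⟨⟨fun i => x.coeff (i + h)⟩, OWitt.ext (funext fun i => ?_)⟩
    rw [key]
    split_ifs with hi
    · exact congrArg x.coeff (Nat.sub_add_cancel hi).symm
    · exact hx i (not_le.1 hi)
  · rintro ⟨y, rfl⟩ i hi
    rw [key, if_neg (not_le.2 hi)]

variable {B : Type w} [CommRing B] [Algebra 𝓀[K] B]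

theorem comp_structureMap (f : A →ₐ[𝓀[K]] B) :
    (f : A →+* B).comp (structureMap K A) = structureMap K B := by
  rw [structureMap, ← RingHom.comp_assoc, f.comp_algebraMap, structureMap]

variable (ϖ) in
/-- The ring homomorphism `𝕎(A) → 𝕎(B)` induced by `f : A → B`. -/
noncomputable def map (f : A →ₐ[𝓀[K]] B) : OWitt ϖ A →+* OWitt ϖ B where
  toFun x := ⟨fun i => f (x.coeff i)⟩
  map_zero' := OWitt.ext (funext fun i => by simp only [zero_coeff, map_zero])
  map_one' := OWitt.ext (funext fun i => by
    simp only [one_coeff]; split_ifs <;> simp)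
  map_add' x y := by
    refine OWitt.ext ?_
    by_cases hK : CharZero K
    · have := RamWitt.map_add ϖ.val (Nat.card 𝓀[K]) (structureMap K A) (f : A →+* B)
        x.coeff y.coeff
      rw [comp_structureMap] at this
      simp only [add_coeff_of_charZero hK]
      exact this
    · funext i
      simp only [add_coeff_of_not_charZero hK, map_add]
  map_mul' x y := by
    refine OWitt.ext ?_
    by_cases hK : CharZero K
    · have := RamWitt.map_mul ϖ.val (Nat.card 𝓀[K]) (structureMap K A) (f : A →+* B)
        x.coeff y.coeff
      rw [comp_structureMap] at this
      simp only [mul_coeff_of_charZero hK]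
      exact this
    · funext i
      simp only [mul_coeff_of_not_charZero hK, map_sum, map_mul]

end OWitt

/-- The truncated ring `𝕎_h(A) = 𝕎(A) / V ^ h 𝕎(A)`. -/
abbrev TruncOWitt (ϖ : Uniformizer K) (h : ℕ) (A : Type v) [CommRing A] [Algebra 𝓀[K] A] :
    Type v :=
  OWitt ϖ A ⧸ OWitt.fil ϖ A h

/-! ## The scheme `X_h`

The indices `1, …, n` are represented by the elements `0, …, n - 1` of `Fin n`, and
`l : Fin (h - 1)` stands for the integer `l + 1` in `{1, …, h - 1}`. -/

namespace Xh

section combinatorics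

variable (n : ℕ) [NeZero n] (k : ℕ)

/-- The permutation `σ` with `Π⁻ᵏ diag(y₁, …, yₙ) Πᵏ = diag(y_{σ(1)}, …, y_{σ(n)})`, for
`Π` the matrix with entries `1` at the places `(i, i + 1)` and `π` at the place `(n, 1)`; that is,
`σ(i) ≡ i - k` modulo `n`. -/
def sigma (i : Fin n) : Fin n := i - Fin.ofNat n k

/-- The bijection `τ : {1, …, n} → {0, …, n - 1}` with `τ(1) = 0` and
`τ(σ(i)) ≡ τ(i) - 1` modulo `n` (for `k` prime to `n`). -/
def tau (i : Fin n) : ℕ := (((i : ℕ) : ZMod n) * (k : ZMod n)⁻¹).val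

theorem tau_lt (i : Fin n) : tau n k i < n := ZMod.val_lt _

theorem tau_zero : tau n k 0 = 0 := by simp [tau]

theorem tau_sigma (hk : k.Coprime n) (i : Fin n) :
    (tau n k (sigma n k i) : ZMod n) = tau n k i - 1 := by
  have h1 : (((sigma n k i : Fin n) : ℕ) : ZMod n) = ((i : ℕ) : ZMod n) - k := by
    have h2 : ((sigma n k i + Fin.ofNat n k : Fin n) : ℕ) = i := by
      rw [sigma, sub_add_cancel]
    have h3 := congrArg (Nat.cast : ℕ → ZMod n) h2
    rw [Fin.val_add, ZMod.natCast_mod, Nat.cast_add] at h3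
    simp only [Fin.ofNat, ZMod.natCast_mod] at h3
    rw [← h3, add_sub_cancel_right]
  rw [tau, tau, ZMod.natCast_zmod_val, ZMod.natCast_zmod_val, h1, sub_mul,
    ZMod.coe_mul_inv_eq_one k hk]

end combinatorics

variable (ϖ : Uniformizer K) (n k h : ℕ)

/-- The index set `𝒜⁺ = {(i, j, l) : 1 ≤ i, j ≤ n, 1 ≤ l ≤ h - 1}`. -/
abbrev Index (n h : ℕ) : Type := Fin n × Fin n × Fin (h - 1)

section points

variable {A : Type v} [CommRing A] [Algebra 𝓀[K] A]

variable {n h} in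
/-- The element `M_{i,j}`: it is `[1, M_{(i,i,1)}, …, M_{(i,i,h-1)}]` in `𝕎_h(A)` for `i = j`, and
`[M_{(i,j,1)}, …, M_{(i,j,h-1)}]` in `𝕎_{h-1}(A)` for `i ≠ j`.  It is lifted to `𝕎(A)` by zeros;
the class in `𝕎_h(A)` of the determinant below does not depend on the lifts. -/
def entry (M : Index n h → A) (i j : Fin n) : OWitt ϖ A := ⟨fun m =>
  if i = j then
    if m = 0 then 1 else if hm : m - 1 < h - 1 then M (i, j, ⟨m - 1, hm⟩) else 0
  else
    if hm : m < h - 1 then M (i, j, ⟨m, hm⟩) else 0⟩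

variable {n h} in
/-- The matrix in standard form with coordinates `M`: its entry at `(i, j)` is `M_{i,j}` for
`i ≤ j` and `π M_{i,j}` for `i > j`.  In other words, it is the sum over `0 ≤ m < n` of
`diag(M_{1,1+m}, …, M_{n,n+m}) Πᵐ`, with second indices modulo `n` and `Π` the matrix with
entries `1` at the places `(i, i + 1)` and `π` at the place `(n, 1)`. -/
noncomputable def stdMatrix (M : Index n h → A) : Matrix (Fin n) (Fin n) (OWitt ϖ A) :=
  Matrix.of fun i j =>
    if j < i then OWitt.unif ϖ A * entry ϖ M i j else entry ϖ M i j

variable {n h} {B : Type w} [CommRing B] [Algebra 𝓀[K] B]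

theorem map_stdMatrix (f : A →ₐ[𝓀[K]] B) (M : Index n h → A) :
    (OWitt.map ϖ f).mapMatrix (stdMatrix ϖ M) = stdMatrix ϖ (fun a => f (M a)) := by
  have h1 : OWitt.map ϖ f (OWitt.unif ϖ A) = OWitt.unif ϖ B := by
    refine OWitt.ext (funext fun m => ?_)
    change f ((OWitt.unif ϖ A).coeff m) = _
    rw [OWitt.unif_coeff, OWitt.unif_coeff]
    split_ifs <;> simp
  have h2 : ∀ i j, OWitt.map ϖ f (entry ϖ M i j) = entry ϖ (fun a => f (M a)) i j := by
    intro i j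
    refine OWitt.ext (funext fun m => ?_)
    change f ((entry ϖ M i j).coeff m) = _
    rw [entry, entry]
    dsimp only
    split_ifs <;> simp
  refine Matrix.ext fun i j => ?_
  simp only [RingHom.mapMatrix_apply, Matrix.map_apply, stdMatrix, Matrix.of_apply]
  split_ifs
  · rw [map_mul, h1, h2]
  · rw [h2]

variable (n h) [NeZero n]

variable (A) in
/-- The points of `X_h` in an algebra `A`: the matrices in standard form with
`M_{i,σʲ(i)} = φ^{τ(i)}(M_{1,σʲ(1)})` for all `i` and `j`, and
`φ(det M) = det M` in `𝕎_h(A)`. -/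
def points : Set (Index n h → A) :=
  {M | (∀ (i : Fin n) (j : ℕ) (l : Fin (h - 1)),
      M (i, (sigma n k)^[j] i, l) =
        M (0, (sigma n k)^[j] 0, l) ^ (Nat.card 𝓀[K] ^ tau n k i)) ∧
    (Ideal.Quotient.mk (OWitt.fil ϖ A h) (OWitt.frob (stdMatrix ϖ M).det) : TruncOWitt ϖ h A) =
      Ideal.Quotient.mk (OWitt.fil ϖ A h) (stdMatrix ϖ M).det}

variable {ϖ n k h} in
theorem points_map (f : A →ₐ[𝓀[K]] B) {M : Index n h → A} (hM : M ∈ points ϖ n k h A) :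
    (fun a => f (M a)) ∈ points ϖ n k h B := by
  refine ⟨fun i j l => by dsimp only; rw [hM.1 i j l, map_pow], ?_⟩
  have h1 := hM.2
  rw [Ideal.Quotient.eq] at h1 ⊢
  rw [← map_stdMatrix, ← RingHom.map_det]
  have h2 : OWitt.frob (OWitt.map ϖ f (stdMatrix ϖ M).det) =
      OWitt.map ϖ f (OWitt.frob (stdMatrix ϖ M).det) := by
    exact OWitt.ext (funext fun m => (map_pow f _ _).symm)
  rw [h2, ← map_sub]
  intro m hm
  change f _ = 0
  rw [h1 m hm, map_zero]

end points

/-- The functor of points `A ↦ X_h(A)` on the algebras over an extension `𝕜` of the residue field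
of `K`. -/
noncomputable def functor [NeZero n] (𝕜 : Type v) [Field 𝕜] [Algebra 𝓀[K] 𝕜] :
    CommAlgCat.{v} 𝕜 ⥤ Type v where
  obj A :=
    letI := Algebra.compHom A (algebraMap 𝓀[K] 𝕜)
    points ϖ n k h A
  map {A B} f :=
    letI := Algebra.compHom A (algebraMap 𝓀[K] 𝕜)
    letI := Algebra.compHom B (algebraMap 𝓀[K] 𝕜)
    TypeCat.ofHom fun M => ⟨fun a => f (M.1 a), points_map (AlgHom.mk (f.hom : A →+* B)
      fun r => f.hom.commutes (algebraMap 𝓀[K] 𝕜 r)) M.2⟩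

end Xh

end OWitt

/-- The functor `A ↦ Hom_𝕜(Spec A, X)` of points of a scheme `X` over a field `𝕜`, on `𝕜`-algebras. -/
noncomputable def pointsFunctor {𝕜 : Type v} [Field 𝕜] (X : Over (Spec (CommRingCat.of 𝕜))) :
    CommAlgCat.{v} 𝕜 ⥤ Type v :=
  (algSpec (CommRingCat.of 𝕜)).rightOp ⋙ yoneda.obj X

/-! Since `k` is prime to `n`, the powers of `σ` move the first index to every index, so the first
condition says that `M` is determined by its first row `x`, which is arbitrary: `n(h-1)` free
coordinates (`mem_points_iff`). Congruence modulo `V^h` is equality of the first `h` coordinates, so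
the second condition reads `d_l ^ q = d_l` for the coordinates `d_l` of `det M`. The equation for
`d_0` is void: modulo `V` the matrix is upper unitriangular, so `d_0 = 1`.

The key point is how `d_l` depends on the coordinates `x_l` of the first diagonal entry. Since `V ·
V^l ⊆ V^(l+1)`, a change of the diagonal by elements of `V^l` changes the determinant by their sum
modulo `V^(l+1)`. The `i`-th diagonal entry is the twist by `φ^τ(i)` of the first, hence `d_l = x_l
+ x_l^q + … + x_l^(q^(n-1)) + c_l`, where `c_l` involves only off-diagonal coordinates and the `x_m`
with `m < l` (`detCoeff_eq`). The sum telescopes in `d_l^q - d_l`, and the equation becomes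
`x_l^(q^n) - x_l + (c_l^q - c_l) = 0` (`detCoeff_pow_sub`).

So `X_h` is a tower of `h-1` Artin–Schreier type extensions over the affine space of the
`(n-1)(h-1)` off-diagonal coordinates. The Jacobian in the `x_l` is triangular with diagonal `-1`,
which gives smoothness (`Tower.isStandardSmooth`); the coordinate ring is integral over the
polynomial ring and contains it, which gives the dimension (`Tower.ringKrullDim_eq`). -/

section integral

/-! ### Krull dimension of integral extensions. -/

theorem ringKrullDim_eq_of_isIntegral_of_injective {B : Type u} {S : Type v} [CommRing B]
    [CommRing S] [Algebra B S] [Algebra.IsIntegral B S]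
    (hinj : Function.Injective (algebraMap B S)) : ringKrullDim S = ringKrullDim B := by
  apply le_antisymm
  -- Incomparability: contraction of primes is strictly monotone.
  · refine Order.krullDim_le_of_strictMono (PrimeSpectrum.comap (algebraMap B S)) fun p q hpq => ?_
    exact Ideal.IsIntegral.comap_lt_comap hpq
  -- Lying over for the bottom of the chain, where injectivity is needed, then going up for the
  -- rest.
  · refine iSup_le fun l => ?_
    obtain ⟨P, -, hP, hP'⟩ := Ideal.exists_ideal_over_prime_of_isIntegral
      (RelSeries.head l).asIdeal (⊥ : Ideal S) (by
        rw [← RingHom.ker_eq_comap_bot, (RingHom.injective_iff_ker_eq_bot _).1 hinj]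
        exact bot_le)
    have : P.LiesOver (RelSeries.head l).asIdeal := ⟨hP'.symm⟩
    obtain ⟨L, hL, -⟩ := Ideal.exists_ltSeries_of_hasGoingUp l P
    rw [← hL]
    exact le_iSup (fun L : LTSeries (PrimeSpectrum S) => (L.length : WithBot ℕ∞)) L

end integral

/-! ### Towers of Artin–Schreier type equations. -/

namespace Tower

open MvPolynomial

variable {𝕜 : Type v} [Field 𝕜] {ι : Type} {m : ℕ} {a : Fin m → ι} {N : ℕ}
  {g : Fin m → MvPolynomial ι 𝕜}

/-- The variables on which the constant term of the `l`-th equation may depend. -/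
def free (a : Fin m → ι) (l : Fin m) : Set ι := {i | ∀ l', i = a l' → l' < l}

/-- The equations of a tower of extensions of Artin-Schreier type. -/
noncomputable def rel (a : Fin m → ι) (N : ℕ) (g : Fin m → MvPolynomial ι 𝕜) (l : Fin m) :
    MvPolynomial ι 𝕜 :=
  X (a l) ^ N - X (a l) + g l

/-- The algebra defined by the equations of a tower. -/
abbrev Ring (a : Fin m → ι) (N : ℕ) (g : Fin m → MvPolynomial ι 𝕜) : Type v :=
  MvPolynomial ι 𝕜 ⧸ Ideal.span (Set.range (rel a N g))

/-- Triangularity of the Jacobian: `N = 0` in `𝕜` kills the derivative of the `N`-th power, and `g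
l` does not involve the variable `a l'` for `l' ≥ l`. -/
theorem pderiv_rel (ha : Function.Injective a) (hN : (N : 𝕜) = 0)
    (hg : ∀ l, g l ∈ supported 𝕜 (free a l)) {l l' : Fin m} (hl : l ≤ l') :
    pderiv (a l') (rel a N g l) = if l' = l then -1 else 0 := by
  classical
  have h1 : pderiv (a l') (g l) = 0 := by
    refine pderiv_eq_zero_of_notMem_vars fun hmem => ?_
    exact absurd (mem_supported.1 (hg l) hmem l' rfl) (not_lt.2 hl)
  have h2 : (N : MvPolynomial ι 𝕜) = 0 := by
    rw [← map_natCast (C : 𝕜 →+* MvPolynomial ι 𝕜), hN, map_zero]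
  rw [rel, map_add, map_sub, Derivation.leibniz_pow, h1, pderiv_X, nsmul_eq_mul, h2, zero_mul,
    zero_sub, add_zero]
  by_cases h : l' = l
  · subst h; simp
  · rw [if_neg h, Pi.single_eq_of_ne (fun h' => h (ha h'.symm)), neg_zero]

/-- In the naive presentation with the `a l` as distinguished variables, the Jacobian determinant is
a power of `-1`, hence a unit. -/
theorem isStandardSmooth [Finite ι] (ha : Function.Injective a) (hN : (N : 𝕜) = 0)
    (hg : ∀ l, g l ∈ supported 𝕜 (free a l)) :
    Algebra.IsStandardSmoothOfRelativeDimension (Nat.card ι - m) 𝕜 (Ring a N g) := by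
  let P : Algebra.PreSubmersivePresentation 𝕜 (Ring a N g) ι (Fin m) :=
    Algebra.PreSubmersivePresentation.naive a ha
  let P' : Algebra.SubmersivePresentation 𝕜 (Ring a N g) ι (Fin m) := ⟨P, by
    rw [P.jacobian_eq_jacobiMatrix_det, Matrix.det_of_isUpperTriangular]
    · refine IsUnit.map _ ?_
      rw [Finset.prod_congr rfl fun l _ => (P.jacobiMatrix_apply l l).trans
        ((pderiv_rel ha hN hg le_rfl).trans (if_pos rfl)), Finset.prod_const]
      exact isUnit_one.neg.pow _
    · intro l l' hll
      exact (P.jacobiMatrix_apply l l').trans ((pderiv_rel ha hN hg (le_of_lt hll)).trans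
        (if_neg (ne_of_gt hll)))⟩
  refine P'.isStandardSmoothOfRelativeDimension ?_
  simp [Algebra.Presentation.dimension]

theorem isIntegral_of_supported {B S : Type*} [CommRing B] [CommRing S] [Algebra B S] [Algebra 𝕜 B]
    [Algebra 𝕜 S] [IsScalarTower 𝕜 B S] {y : ι → S} {s : Set ι}
    (hy : ∀ i ∈ s, IsIntegral B (y i)) {f : MvPolynomial ι 𝕜} (hf : f ∈ supported 𝕜 s) :
    IsIntegral B (aeval y f) := by
  have h : supported 𝕜 s ≤ ((integralClosure B S).restrictScalars 𝕜).comap (aeval y) := by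
    refine Algebra.adjoin_le ?_
    rintro _ ⟨i, hi, rfl⟩
    change IsIntegral B (aeval y (X i))
    rw [aeval_X]
    exact hy i hi
  exact h hf

theorem isIntegral_of_pow_sub_add_eq_zero {B S : Type*} [CommRing B] [CommRing S] [Algebra B S]
    {N : ℕ} (hN : 2 ≤ N) {x c : S} (hc : IsIntegral B c) (h : x ^ N - x + c = 0) :
    IsIntegral B x := by
  refine isIntegral_trans (A := integralClosure B S) x ?_
  refine ⟨Polynomial.X ^ N - (Polynomial.X - Polynomial.C (⟨c, hc⟩ : integralClosure B S)),
    Polynomial.monic_X_pow_sub ?_, ?_⟩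
  · exact (Polynomial.degree_X_sub_C_le _).trans_lt (by exact_mod_cast hN)
  · simp only [Polynomial.eval₂_sub, Polynomial.eval₂_X_pow, Polynomial.eval₂_X,
      Polynomial.eval₂_C]
    change x ^ N - (x - c) = 0
    rw [← h]; ring

theorem aeval_congr {S : Type*} [CommRing S] [Algebra 𝕜 S] {y z : ι → S} {s : Set ι}
    (hy : ∀ i ∈ s, y i = z i) {f : MvPolynomial ι 𝕜} (hf : f ∈ supported 𝕜 s) :
    aeval y f = aeval z f :=
  eval₂Hom_congr' rfl (fun i hi _ => hy i (mem_supported.1 hf hi)) rfl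

/-- Over an algebraically closed field, the equations of a tower can be solved with any prescribed
values of the other variables. -/
theorem exists_solution {Ω : Type*} [Field Ω] [IsAlgClosed Ω] [Algebra 𝕜 Ω]
    (ha : Function.Injective a) (hN : 2 ≤ N)
    (hg : ∀ l, g l ∈ supported 𝕜 (free a l)) (z : ι → Ω) :
    ∃ y : ι → Ω, (∀ i ∉ Set.range a, y i = z i) ∧ ∀ l, aeval y (rel a N g l) = 0 := by
  classical
  -- The equations are solved one at a time, in the order of the tower.
  suffices H : ∀ k : ℕ, ∃ y : ι → Ω, (∀ i ∉ Set.range a, y i = z i) ∧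
      ∀ l : Fin m, (l : ℕ) < k → aeval y (rel a N g l) = 0 by
    obtain ⟨y, h1, h2⟩ := H m
    exact ⟨y, h1, fun l => h2 l l.2⟩
  intro k
  induction k with
  | zero => exact ⟨z, fun _ _ => rfl, fun l hl => absurd hl (Nat.not_lt_zero _)⟩
  | succ k ih =>
    obtain ⟨y, h1, h2⟩ := ih
    by_cases hk : k < m
    · let p : Polynomial Ω := Polynomial.X ^ N -
        (Polynomial.X - Polynomial.C (aeval y (g ⟨k, hk⟩)))
      have hp : p.degree = N := by
        rw [Polynomial.degree_sub_eq_left_of_degree_lt, Polynomial.degree_X_pow]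
        rw [Polynomial.degree_X_pow]
        exact (Polynomial.degree_X_sub_C_le _).trans_lt (by exact_mod_cast hN)
      obtain ⟨t, ht⟩ := IsAlgClosed.exists_root p (by rw [hp]; simp; omega)
      have ht' : t ^ N - (t - aeval y (g ⟨k, hk⟩)) = 0 := by
        simpa only [p, Polynomial.IsRoot.def, Polynomial.eval_sub, Polynomial.eval_pow,
          Polynomial.eval_X, Polynomial.eval_C] using ht
      refine ⟨Function.update y (a ⟨k, hk⟩) t, fun i hi => ?_, fun l hl => ?_⟩
      · rw [Function.update_of_ne (fun h => hi ⟨_, h.symm⟩), h1 i hi]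
      -- Changing the value at `a k` affects neither the constant terms of the equations up to `k`
      -- nor the variables `a l` with `l < k`, so the earlier equations stay solved.
      · have hgl : aeval (Function.update y (a ⟨k, hk⟩) t) (g l) = aeval y (g l) := by
          refine aeval_congr (s := free a l) (fun i hi => ?_) (hg l)
          refine Function.update_of_ne (fun h => ?_) _ _
          have := Fin.lt_def.1 (hi _ h)
          simp only at this
          omega
        rcases eq_or_ne l ⟨k, hk⟩ with rfl | hne
        · rw [rel, map_add, hgl, map_sub, map_pow, aeval_X, Function.update_self, ← ht']
          ring
        · have hlk : (l : ℕ) < k := by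
            have : (l : ℕ) ≠ k := fun h => hne (Fin.ext h)
            omega
          rw [← h2 l hlk, rel, map_add, map_add, hgl, map_sub, map_pow, aeval_X,
            Function.update_of_ne (fun h => hne (ha h)), map_sub, map_pow, aeval_X]
    · exact ⟨y, h1, fun l hl => h2 l (by omega)⟩

theorem ringKrullDim_eq [Finite ι] (ha : Function.Injective a) (hN : 2 ≤ N)
    (hg : ∀ l, g l ∈ supported 𝕜 (free a l)) :
    ringKrullDim (Ring a N g) = ((Nat.card ι - m : ℕ) : WithBot ℕ∞) := by
  classical
  let B := MvPolynomial {i // i ∉ Set.range a} 𝕜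
  let φ : B →ₐ[𝕜] Ring a N g :=
    (Ideal.Quotient.mkₐ 𝕜 _).comp (rename (Subtype.val : {i // i ∉ Set.range a} → ι))
  let _ : Algebra B (Ring a N g) := φ.toRingHom.toAlgebra
  have : IsScalarTower 𝕜 B (Ring a N g) := IsScalarTower.of_algebraMap_eq fun r =>
    (φ.commutes r).symm
  let x : ι → Ring a N g := fun i => Ideal.Quotient.mk _ (X i)
  have haeval : ∀ f, aeval x f = (Ideal.Quotient.mk _ f : Ring a N g) := fun f =>
    DFunLike.congr_fun (aeval_unique (Ideal.Quotient.mkₐ 𝕜 (Ideal.span (Set.range (rel a N g)))))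
      f |>.symm
  have hrel : ∀ l, x (a l) ^ N - x (a l) + aeval x (g l) = 0 := fun l => by
    have h := haeval (rel a N g l)
    rw [Ideal.Quotient.eq_zero_iff_mem.2 (Ideal.subset_span (Set.mem_range_self l)), rel] at h
    simpa only [map_add, map_sub, map_pow, aeval_X] using h
  have hfree : ∀ i ∉ Set.range a, IsIntegral B (x i) := fun i hi => by
    have : x i = algebraMap B (Ring a N g) (X ⟨i, hi⟩) := by
      change _ = φ (X ⟨i, hi⟩)
      change Ideal.Quotient.mk _ (X i) = Ideal.Quotient.mk _ (rename Subtype.val (X ⟨i, hi⟩))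
      rw [rename_X]
    rw [this]
    exact isIntegral_algebraMap
  -- Climbing the tower: the constant term of an equation is a polynomial in elements already known
  -- to be integral, and the equation is monic because `N ≥ 2`.
  have hx : ∀ l : Fin m, IsIntegral B (x (a l)) := by
    intro l
    induction l using WellFoundedLT.induction with
    | _ l ih =>
      refine isIntegral_of_pow_sub_add_eq_zero hN
        (isIntegral_of_supported (fun i hi => ?_) (hg l)) (hrel l)
      by_cases h : i ∈ Set.range a
      · obtain ⟨l', rfl⟩ := h
        exact ih l' (hi l' rfl)
      · exact hfree i h
  have hall : ∀ i, IsIntegral B (x i) := fun i => by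
    by_cases h : i ∈ Set.range a
    · obtain ⟨l', rfl⟩ := h
      exact hx l'
    · exact hfree i h
  have : Algebra.IsIntegral B (Ring a N g) := ⟨fun s => by
    obtain ⟨f, rfl⟩ := Ideal.Quotient.mk_surjective s
    rw [← haeval]
    exact isIntegral_of_supported (s := Set.univ) (fun i _ => hall i) (by simp)⟩
  have hinj : Function.Injective (algebraMap B (Ring a N g)) := by
    let Ω := AlgebraicClosure (FractionRing B)
    let z : ι → Ω := fun i => if hi : i ∉ Set.range a then algebraMap B Ω (X ⟨i, hi⟩) else 0
    obtain ⟨y, hy1, hy2⟩ := exists_solution ha hN hg z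
    let ψ : Ring a N g →ₐ[𝕜] Ω := Ideal.Quotient.liftₐ _ (aeval y) (by
      intro f hf
      have : Ideal.span (Set.range (rel a N g)) ≤ RingHom.ker (aeval y : _ →ₐ[𝕜] Ω) := by
        rw [Ideal.span_le]
        rintro _ ⟨l, rfl⟩
        exact hy2 l
      exact this hf)
    have hcomp : ψ.comp φ = IsScalarTower.toAlgHom 𝕜 B Ω := by
      refine MvPolynomial.algHom_ext fun i => ?_
      have h1 : ψ (φ (X i)) = y i := by
        change ψ (Ideal.Quotient.mk _ (rename _ (X i))) = _
        rw [rename_X]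
        change aeval y (X (i : ι)) = _
        rw [aeval_X]
      rw [AlgHom.comp_apply, h1, hy1 i i.2]
      simp only [z]
      rw [dif_pos i.2]
      rfl
    have h2 : Function.Injective (ψ ∘ φ) := by
      rw [← AlgHom.coe_comp, hcomp]
      exact (algebraMap (FractionRing B) Ω).injective.comp
        (IsFractionRing.injective B (FractionRing B))
    exact h2.of_comp
  rw [ringKrullDim_eq_of_isIntegral_of_injective hinj,
    MvPolynomial.ringKrullDim_of_isNoetherianRing, ringKrullDim_eq_zero_of_field, zero_add]
  congr 2
  have := Fintype.ofFinite ι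
  have h := Nat.card_congr (Equiv.ofInjective a ha)
  rw [Nat.card_eq_fintype_card, Fintype.card_fin] at h
  rw [Nat.card_eq_fintype_card] at h
  rw [Nat.card_eq_fintype_card, Nat.card_eq_fintype_card,
    Fintype.card_subtype_compl (fun i => i ∈ Set.range a)]
  exact congrArg (Fintype.card ι - ·) h.symm

end Tower

/-! ### Determinants of matrices that are unipotent modulo an ideal. -/

section det

variable {R : Type*} [CommRing R] {I J J' : Ideal R}

theorem Finset.prod_sub_prod_mem {ι : Type*} (s : Finset ι) {a b : ι → R}
    (h : ∀ i ∈ s, a i - b i ∈ J) : ∏ i ∈ s, a i - ∏ i ∈ s, b i ∈ J := by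
  rw [← Ideal.Quotient.eq, map_prod, map_prod]
  exact Finset.prod_congr rfl fun i hi => Ideal.Quotient.eq.2 (h i hi)

/-- First-order expansion: each `u i` occurs with a cofactor that is `1` modulo `I`, and `I · J ⊆
J'` absorbs the error. The hypothesis `J ≤ I` also puts the terms of higher order in `u` into `J'`.
-/
theorem Finset.prod_add_sub_mem (hIJ : ∀ x ∈ I, ∀ y ∈ J, x * y ∈ J') (hJI : J ≤ I)
    {ι : Type*} (s : Finset ι) {m u : ι → R} (hm : ∀ i ∈ s, m i - 1 ∈ I) (hu : ∀ i ∈ s, u i ∈ J) :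
    ∏ i ∈ s, (m i + u i) - ∏ i ∈ s, m i - ∑ i ∈ s, u i ∈ J' := by
  classical
  induction s using Finset.induction_on with
  | empty => simp
  | insert i s hi ih =>
    have h1 := ih (fun j hj => hm j (Finset.mem_insert_of_mem hj))
      (fun j hj => hu j (Finset.mem_insert_of_mem hj))
    have h2 : ∑ j ∈ s, u j ∈ J := J.sum_mem fun j hj => hu j (Finset.mem_insert_of_mem hj)
    have h3 : ∏ j ∈ s, (m j + u j) - 1 ∈ I := by
      have := Finset.prod_sub_prod_mem (J := I) s (a := fun j => m j + u j) (b := fun _ => 1)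
        fun j hj => by
          have := I.add_mem (hm j (Finset.mem_insert_of_mem hj))
            (hJI (hu j (Finset.mem_insert_of_mem hj)))
          convert this using 1; ring
      simpa using this
    have h4 := hIJ _ (hm i (Finset.mem_insert_self i s)) _ h2
    have h5 := hIJ _ h3 _ (hu i (Finset.mem_insert_self i s))
    rw [Finset.prod_insert hi, Finset.prod_insert hi, Finset.sum_insert hi]
    convert J'.add_mem (J'.add_mem (J'.mul_mem_left (m i) h1) h4) h5 using 1
    ring

/-- A perturbation of the diagonal of a unipotent matrix changes its determinant by the trace. -/
theorem Matrix.det_add_diagonal_sub_mem {n : Type*} [Fintype n] [LinearOrder n]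
    (hIJ : ∀ x ∈ I, ∀ y ∈ J, x * y ∈ J') (hJI : J ≤ I)
    {M : Matrix n n R} {u : n → R} (hdiag : ∀ i, M i i - 1 ∈ I) (hlow : ∀ i j, j < i → M i j ∈ I)
    (hu : ∀ i, u i ∈ J) : (M + Matrix.diagonal u).det - M.det - ∑ i, u i ∈ J' := by
  rw [Matrix.det_apply, Matrix.det_apply, ← Finset.sum_sub_distrib,
    ← Finset.add_sum_erase _ _ (Finset.mem_univ (1 : Equiv.Perm n)), add_sub_right_comm]
  -- The identity permutation contributes the trace; every other term changes only within `J'`.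
  refine J'.add_mem ?_ (J'.sum_mem fun σ hσ => ?_)
  · simpa using Finset.prod_add_sub_mem hIJ hJI Finset.univ (fun i _ => hdiag i) (fun i _ => hu i)
  · rw [← smul_sub]
    refine J'.smul_of_tower_mem _ ?_
    -- A permutation with `σ i ≤ i` for all `i` is the identity. The entry at `(σ i, i)` then lies
    -- below the diagonal, so it is in `I` and is not perturbed, while the product of the other
    -- factors changes by an element of `J`.
    obtain ⟨i, hi⟩ : ∃ i, i < σ i := by
      by_contra! h
      refine (Finset.mem_erase.1 hσ).1 (Equiv.ext fun i => ?_)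
      induction i using WellFoundedLT.induction with
      | _ i ih =>
        rcases (h i).lt_or_eq with hlt | heq
        · have := ih _ hlt
          simp only [Equiv.Perm.one_apply, EmbeddingLike.apply_eq_iff_eq] at this
          exact absurd this hlt.ne
        · exact heq
    rw [← Finset.mul_prod_erase _ _ (Finset.mem_univ i),
      ← Finset.mul_prod_erase _ _ (Finset.mem_univ i), Matrix.add_apply,
      Matrix.diagonal_apply_ne _ hi.ne', add_zero, ← mul_sub]
    refine hIJ _ (hlow _ _ hi) _ (Finset.prod_sub_prod_mem _ fun j _ => ?_)
    rw [Matrix.add_apply, add_sub_cancel_left, Matrix.diagonal_apply]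
    split_ifs
    · exact hu _
    · exact J.zero_mem

/-- The determinant of a unipotent matrix. -/
theorem Matrix.det_sub_one_mem {n : Type*} [Fintype n] [LinearOrder n]
    {M : Matrix n n R} (hdiag : ∀ i, M i i - 1 ∈ I) (hlow : ∀ i j, j < i → M i j ∈ I) :
    M.det - 1 ∈ I := by
  rw [← Ideal.Quotient.eq, map_one, RingHom.map_det, Matrix.det_of_isUpperTriangular]
  · refine Finset.prod_eq_one fun i _ => ?_
    exact (Ideal.Quotient.eq.2 (hdiag i)).trans (map_one _)
  · intro i j hij
    exact Ideal.Quotient.eq_zero_iff_mem.2 (hlow i j hij)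

end det

/-! ### Leading coordinates of sums and products of ramified Witt vectors. -/

namespace RamWitt

variable {O : Type u} [CommRing O] {ϖ : O} {q : ℕ} {R : Type v} [CommRing R] (ρ : O →+* R)

theorem C_pow_mul_cancel (B : IsBase ϖ q) {σ : Type w} (m : ℕ) {f g : MvPolynomial σ O}
    (H : MvPolynomial.C ϖ ^ m * f = MvPolynomial.C ϖ ^ m * g) : f = g := by
  induction m generalizing f g with
  | zero => simpa using H
  | succ m ih =>
    rw [pow_succ, mul_assoc, mul_assoc] at H
    have h1 := ih H
    ext d
    have h2 := congrArg (MvPolynomial.coeff d) h1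
    rw [MvPolynomial.coeff_C_mul, MvPolynomial.coeff_C_mul, ← sub_eq_zero, ← mul_sub] at h2
    exact sub_eq_zero.1 (B.regular _ h2)

theorem ghost_eq_of_lt (B : IsBase ϖ q) {h : ℕ} {x : ℕ → R} (hx : ∀ i < h, x i = 0) :
    ghost ϖ q ρ x h = ρ ϖ ^ h * x h := by
  rw [ghost, Finset.sum_range_succ, Finset.sum_eq_zero, zero_add, Nat.sub_self, pow_zero, pow_one]
  intro i hi
  rw [hx i (Finset.mem_range.1 hi), zero_pow (pow_pos B.q_pos _).ne', mul_zero]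

/-- After lifting to a polynomial ring over `O`, the ghost components of `u` vanish below `h`, and
the `h`-th is `ϖ ^ h * u h`. Comparing ghost components and cancelling `ϖ ^ h` gives both claims. -/
theorem add_of_lt (B : IsBase ϖ q) {h : ℕ} (x : ℕ → R) {u : ℕ → R} (hu : ∀ i < h, u i = 0) :
    (∀ i < h, add ϖ q ρ x u i = x i) ∧ add ϖ q ρ x u h = x h + u h := by
  obtain ⟨x, rfl⟩ := exists_lift ρ x
  obtain ⟨u, rfl, hu'⟩ := exists_lift_zero ρ hu
  rw [toRing_add]
  have h1 : ∀ i < h, add ϖ q MvPolynomial.C x u i = x i :=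
    ext_of_ghost B fun m hm => by
      rw [ghost_add _ B, ghost_eq_zero _ B hu' m hm, add_zero]
  refine ⟨fun i hi => congrArg (toRing ρ) (h1 i hi), ?_⟩
  refine Eq.trans (congrArg (toRing ρ) ?_) (_root_.map_add _ _ _)
  have h2 := ghost_add MvPolynomial.C B x u h
  rw [ghost_eq_of_lt _ B hu', ghost, ghost, Finset.sum_range_succ, Finset.sum_range_succ,
    Finset.sum_congr rfl fun i hi => by rw [h1 i (Finset.mem_range.1 hi)], add_assoc,
    add_right_inj, Nat.sub_self, pow_zero, pow_one, pow_one, ← mul_add] at h2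
  exact C_pow_mul_cancel B h h2

/-- Only coordinate `h` is new. On the lifts it equals the `h`-th ghost component of `x` times `y
h`, after cancelling `ϖ ^ h`. As `x 0 = 0`, that ghost component is divisible by `ϖ`, which dies in
`R`. -/
theorem mul_lt_succ (B : IsBase ϖ q) (hρ : ρ ϖ = 0) {h : ℕ} {x y : ℕ → R} (hx : x 0 = 0)
    (hy : ∀ i < h, y i = 0) : ∀ i < h + 1, mul ϖ q ρ x y i = 0 := by
  intro i hi
  rcases Nat.lt_succ_iff_lt_or_eq.1 hi with hi | rfl
  · exact mul_lt ρ B x hy i hi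
  obtain ⟨x, rfl, hx'⟩ := exists_lift_zero ρ (h := 1) (x := x)
    (fun i hi => by rw [Nat.lt_one_iff.1 hi, hx])
  obtain ⟨y, rfl, hy'⟩ := exists_lift_zero ρ hy
  rw [toRing_mul]
  have h1 : ghost ϖ q MvPolynomial.C (mul ϖ q MvPolynomial.C x y) i =
      MvPolynomial.C ϖ ^ i * mul ϖ q MvPolynomial.C x y i :=
    ghost_eq_of_lt _ B (mul_lt _ B x hy')
  rw [ghost_mul _ B, ghost_eq_of_lt _ B hy', mul_left_comm] at h1
  have h2 := C_pow_mul_cancel B i h1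
  have h3 : (MvPolynomial.C ϖ) ∣ ghost ϖ q MvPolynomial.C x i := by
    refine Finset.dvd_sum fun j _ => ?_
    rcases j with _ | j
    · rw [hx' 0 one_pos, zero_pow (pow_pos B.q_pos _).ne', mul_zero]
      exact dvd_zero _
    · exact (dvd_pow_self _ j.succ_ne_zero).mul_right _
  obtain ⟨z, hz⟩ := h3
  change toRing ρ (mul ϖ q MvPolynomial.C x y i) = 0
  rw [← h2, hz, mul_assoc, _root_.map_mul]
  have : toRing ρ (MvPolynomial.C ϖ) = 0 := by
    rw [← RingHom.comp_apply, toRing_comp, hρ]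
  rw [this, zero_mul]

end RamWitt

/-! ### The filtration of `𝕎(A)` by the powers of `V`. -/

namespace OWitt

variable {K : Type u} [Field K] [ValuativeRel K] [TopologicalSpace K]
  [IsNonarchimedeanLocalField K] {ϖ : Uniformizer K} {A : Type v} [CommRing A] [Algebra 𝓀[K] A]

theorem add_coeff_of_mem_fil {h : ℕ} (x : OWitt ϖ A) {y : OWitt ϖ A} (hy : y ∈ fil ϖ A h) :
    (∀ i < h, (x + y).coeff i = x.coeff i) ∧ (x + y).coeff h = x.coeff h + y.coeff h := by
  by_cases hK : CharZero K
  · rw [add_coeff_of_charZero hK]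
    exact RamWitt.add_of_lt _ ϖ.isBase _ hy
  · refine ⟨fun i hi => ?_, add_coeff_of_not_charZero hK _ _ _⟩
    rw [add_coeff_of_not_charZero hK, hy i hi, add_zero]

theorem mul_mem_fil_succ {h : ℕ} {x y : OWitt ϖ A} (hx : x ∈ fil ϖ A 1) (hy : y ∈ fil ϖ A h) :
    x * y ∈ fil ϖ A (h + 1) := by
  intro i hi
  by_cases hK : CharZero K
  · rw [mul_coeff_of_charZero hK]
    refine RamWitt.mul_lt_succ _ ϖ.isBase ?_ (hx 0 one_pos) hy i hi
    -- The structure map factors through the residue field, so it kills the uniformizer.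
    rw [structureMap, RingHom.comp_apply, (IsLocalRing.residue_eq_zero_iff _).2, map_zero]
    exact ϖ.irreducible.not_isUnit
  · rw [mul_coeff_of_not_charZero hK]
    refine Finset.sum_eq_zero fun p hp => ?_
    have hp' := Finset.HasAntidiagonal.mem_antidiagonal.1 hp
    rcases Nat.eq_zero_or_pos p.1 with h0 | h0
    · rw [h0, hx 0 one_pos, zero_mul]
    · rw [hy p.2 (by omega), mul_zero]

theorem fil_anti {h h' : ℕ} (hh : h ≤ h') : fil ϖ A h' ≤ fil ϖ A h :=
  fun _ hx i hi => hx i (hi.trans_le hh)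

/-- Subtraction in `𝕎(A)` need not be coordinatewise, but adding an element of `V^h 𝕎(A)` leaves the
coordinates below `h` alone and is additive in coordinate `h`; apply this to `x = y + (x - y)`. -/
theorem sub_mem_fil_iff {h : ℕ} {x y : OWitt ϖ A} :
    x - y ∈ fil ϖ A h ↔ ∀ i < h, x.coeff i = y.coeff i := by
  constructor
  · intro H i hi
    have := (add_coeff_of_mem_fil y H).1 i hi
    rwa [add_sub_cancel] at this
  · intro H
    induction h with
    | zero => exact fun i hi => absurd hi (Nat.not_lt_zero i)
    | succ h ih =>
      have h1 := ih fun i hi => H i (hi.trans (Nat.lt_succ_self h))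
      have h2 := (add_coeff_of_mem_fil y h1).2
      rw [add_sub_cancel, H h (Nat.lt_succ_self h), left_eq_add] at h2
      intro i hi
      rcases Nat.lt_succ_iff_lt_or_eq.1 hi with hi | rfl
      · exact h1 i hi
      · exact h2

theorem sum_coeff_of_mem_fil {h : ℕ} {ι : Type*} (s : Finset ι) {u : ι → OWitt ϖ A}
    (hu : ∀ i ∈ s, u i ∈ fil ϖ A h) : (∑ i ∈ s, u i).coeff h = ∑ i ∈ s, (u i).coeff h := by
  classical
  induction s using Finset.induction_on with
  | empty => exact zero_coeff h
  | insert i s hi ih =>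
    rw [Finset.sum_insert hi, Finset.sum_insert hi, add_comm (u i), add_comm ((u i).coeff h),
      (add_coeff_of_mem_fil _ (hu i (Finset.mem_insert_self i s))).2,
      ih fun j hj => hu j (Finset.mem_insert_of_mem hj)]

end OWitt

/-! ### The determinant as a function of the first row. -/

namespace Xh

section detCoeff

open OWitt

variable {k : ℕ} {K : Type u} [Field K] [ValuativeRel K] [TopologicalSpace K]
  [IsNonarchimedeanLocalField K] (ϖ : Uniformizer K) {n h : ℕ} {A : Type v} [CommRing A]
  [Algebra 𝓀[K] A]

theorem entry_self_sub_one_mem (M : Index n h → A) (i : Fin n) :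
    entry ϖ M i i - 1 ∈ fil ϖ A 1 := by
  refine sub_mem_fil_iff.2 fun m hm => ?_
  rw [Nat.lt_one_iff.1 hm, one_coeff]
  simp [entry]

theorem stdMatrix_self (M : Index n h → A) (i : Fin n) :
    stdMatrix ϖ M i i = entry ϖ M i i := by
  rw [stdMatrix, Matrix.of_apply, if_neg (lt_irrefl i)]

theorem stdMatrix_mem_of_lt (M : Index n h → A) {i j : Fin n} (hij : j < i) :
    stdMatrix ϖ M i j ∈ fil ϖ A 1 := by
  rw [stdMatrix, Matrix.of_apply, if_pos hij]
  refine Ideal.mul_mem_right _ _ fun m hm => ?_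
  rw [Nat.lt_one_iff.1 hm, unif_coeff, if_neg zero_ne_one]

/-- The factor `π` below the diagonal makes the matrix upper unitriangular modulo `V`. Hence `φ(det
M) = det M` imposes nothing on coordinate `0`. -/
theorem det_stdMatrix_coeff_zero (M : Index n h → A) : (stdMatrix ϖ M).det.coeff 0 = 1 := by
  have h1 : (stdMatrix ϖ M).det - 1 ∈ fil ϖ A 1 := Matrix.det_sub_one_mem
    (fun i => by rw [stdMatrix_self]; exact entry_self_sub_one_mem ϖ M i)
    (fun i j hij => stdMatrix_mem_of_lt ϖ M hij)
  rw [sub_mem_fil_iff.1 h1 0 one_pos, one_coeff, if_pos rfl]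

variable (k K) in
/-- The coordinates of the matrix in standard form that satisfies the first condition on the points
of `X_h` and has the first row `x`. -/
noncomputable def extend (x : Fin n × Fin (h - 1) → A) : Index n h → A :=
  fun p => x (p.2.1 - p.1, p.2.2) ^ (Nat.card 𝓀[K] ^ tau n k p.1)

variable (k) in
/-- The coordinates of positive index of the determinant of the matrix with first row `x`. -/
noncomputable def detCoeff (x : Fin n × Fin (h - 1) → A) (l : Fin (h - 1)) : A :=
  (stdMatrix ϖ (extend k K x)).det.coeff (l + 1)

/-- Naturality in `A` allows the determinant to be computed once, on the variables of a polynomial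
ring, and then specialised; it also controls which variables occur (`constTerm_mem`). -/
theorem map_detCoeff {B : Type w} [CommRing B] [Algebra 𝓀[K] B] (f : A →ₐ[𝓀[K]] B)
    (x : Fin n × Fin (h - 1) → A) (l : Fin (h - 1)) :
    f (detCoeff k ϖ x l) = detCoeff k ϖ (fun p => f (x p)) l := by
  have h1 : extend k K (fun p => f (x p)) = fun p => f (extend k K x p) :=
    funext fun p => (map_pow f _ _).symm
  rw [detCoeff, detCoeff, h1, ← map_stdMatrix, ← RingHom.map_det]
  rfl

end detCoeff

/-! ### Combinatorics of `σ` and `τ`. -/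

variable {n : ℕ} [NeZero n] {k : ℕ}

theorem tau_injective (hkn : k.Coprime n) : Function.Injective (tau n k) := by
  intro i j hij
  have hunit : IsUnit ((k : ZMod n)⁻¹) :=
    IsUnit.of_mul_eq_one_right _ (ZMod.coe_mul_inv_eq_one k hkn)
  have h1 := hunit.mul_right_cancel (ZMod.val_injective n hij)
  rw [ZMod.natCast_eq_natCast_iff', Nat.mod_eq_of_lt i.2, Nat.mod_eq_of_lt j.2] at h1
  exact Fin.ext h1

/-- `τ` is a bijection onto `{0, …, n-1}`; this turns the sum of the Frobenius twists over the rows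
into one that telescopes. -/
theorem sum_tau (hkn : k.Coprime n) {M : Type*} [AddCommMonoid M] (f : ℕ → M) :
    ∑ i, f (tau n k i) = ∑ j ∈ Finset.range n, f j := by
  have h1 : Function.Injective fun i : Fin n => (⟨tau n k i, tau_lt n k i⟩ : Fin n) :=
    fun i j hij => tau_injective hkn (congrArg Fin.val hij)
  rw [← Fin.sum_univ_eq_sum_range]
  exact (Equiv.ofBijective _ (Finite.injective_iff_bijective.1 h1)).sum_comp fun j => f j

/-- `σ` is a translation, so `σ^j(i) - i` does not depend on `i`. This is why `extend` reads the
first row at column minus row. -/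
theorem sigma_iterate (i : Fin n) (j : ℕ) :
    (sigma n k)^[j] i = i + (sigma n k)^[j] 0 := by
  induction j with
  | zero => simp
  | succ j ih =>
    rw [Function.iterate_succ_apply', Function.iterate_succ_apply', ih, sigma, sigma,
      add_sub_assoc]

theorem cast_sigma_iterate (j : ℕ) :
    ((((sigma n k)^[j] 0 : Fin n) : ℕ) : ZMod n) = -(j * k) := by
  induction j with
  | zero => simp
  | succ j ih =>
    have h2 : ((sigma n k ((sigma n k)^[j] 0) + Fin.ofNat n k : Fin n) : ℕ) =
        ((sigma n k)^[j] 0 : Fin n) := by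
      rw [sigma, sub_add_cancel]
    have h3 := congrArg (Nat.cast : ℕ → ZMod n) h2
    rw [Fin.val_add, ZMod.natCast_mod, Nat.cast_add, ih] at h3
    simp only [Fin.ofNat, ZMod.natCast_mod] at h3
    rw [Function.iterate_succ_apply', eq_sub_of_add_eq h3]
    push_cast
    ring

theorem exists_sigma_iterate (hkn : k.Coprime n) (d : Fin n) : ∃ j, (sigma n k)^[j] 0 = d := by
  -- The exponent solves `-j k ≡ d` modulo `n`, as `k` is invertible there.
  refine ⟨(-((d : ℕ) : ZMod n) * (k : ZMod n)⁻¹).val, Fin.ext ?_⟩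
  have h1 := cast_sigma_iterate (n := n) (k := k) (-((d : ℕ) : ZMod n) * (k : ZMod n)⁻¹).val
  rw [ZMod.natCast_zmod_val, mul_assoc, mul_comm _ (k : ZMod n), ZMod.coe_mul_inv_eq_one k hkn,
    mul_one, neg_neg, ZMod.natCast_eq_natCast_iff', Nat.mod_eq_of_lt (Fin.is_lt _),
    Nat.mod_eq_of_lt d.2] at h1
  exact h1

/-! ### Equations for the first row. -/

variable {K : Type u} [Field K] [ValuativeRel K] [TopologicalSpace K]
  [IsNonarchimedeanLocalField K] (ϖ : Uniformizer K) {h : ℕ}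

section points

open OWitt

variable {A : Type v} [CommRing A]

theorem extend_zero (x : Fin n × Fin (h - 1) → A) (d : Fin n) (l : Fin (h - 1)) :
    extend k K x (0, d, l) = x (d, l) := by
  rw [extend, tau_zero, pow_zero, pow_one, sub_zero]

variable [Algebra 𝓀[K] A]

theorem mem_points_iff (hkn : k.Coprime n) {M : Index n h → A} :
    M ∈ points ϖ n k h A ↔ M = extend k K (fun p => M (0, p.1, p.2)) ∧
      ∀ l, detCoeff k ϖ (fun p => M (0, p.1, p.2)) l ^ Nat.card 𝓀[K] =
        detCoeff k ϖ (fun p => M (0, p.1, p.2)) l := by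
  have h1 : (∀ (i : Fin n) (j : ℕ) (l : Fin (h - 1)), M (i, (sigma n k)^[j] i, l) =
      M (0, (sigma n k)^[j] 0, l) ^ (Nat.card 𝓀[K] ^ tau n k i)) ↔
      M = extend k K (fun p => M (0, p.1, p.2)) := by
    constructor
    · intro H
      funext ⟨i, d, l⟩
      -- The place `(i, d)` is reached from `(i, i)` by the power of `σ` that sends `0` to `d - i`.
      obtain ⟨j, hj⟩ := exists_sigma_iterate hkn (d - i)
      have := H i j l
      rw [sigma_iterate i j, hj, add_sub_cancel] at this
      exact this
    · intro H i j l
      rw [sigma_iterate i j]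
      refine (congrFun H _).trans ?_
      rw [extend]
      simp only [add_sub_cancel_left]
  rw [points, Set.mem_ofPred_eq, h1]
  refine and_congr_right fun H => ?_
  rw [Ideal.Quotient.eq, sub_mem_fil_iff]
  simp only [detCoeff, ← H]
  constructor
  · intro H' l
    exact H' (l + 1) (by omega)
  · intro H' i hi
    rcases i with _ | i
    · change (stdMatrix ϖ M).det.coeff 0 ^ _ = _
      rw [det_stdMatrix_coeff_zero, one_pow]
    · exact H' ⟨i, by omega⟩

open Classical in
/-- The tuple obtained from `x` by setting to zero the coordinates of the first diagonal entry
from the index `l` on. -/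
noncomputable def truncate (l : Fin (h - 1)) (x : Fin n × Fin (h - 1) → A) :
    Fin n × Fin (h - 1) → A :=
  fun p => if p.1 = 0 ∧ l ≤ p.2 then 0 else x p

/-- Restoring the truncated coordinates perturbs only the diagonal of the matrix, by elements `u i`
of `V^(l+1)` with leading coordinates `x (0, l) ^ (q ^ τ(i))`. The determinant then moves by their
sum modulo `V^(l+2)`. The shift by one comes from `l : Fin (h - 1)` standing for the coordinate `l +
1`. -/
theorem detCoeff_eq (hkn : k.Coprime n) (x : Fin n × Fin (h - 1) → A) (l : Fin (h - 1)) :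
    detCoeff k ϖ x l = detCoeff k ϖ (truncate l x) l +
      ∑ j ∈ Finset.range n, x (0, l) ^ (Nat.card 𝓀[K] ^ j) := by
  set M := extend k K x with hM
  set M' := extend k K (truncate l x) with hM'
  -- Truncation touches only column `0` of the first row, which `extend` spreads along the diagonal.
  have hoff : ∀ i j l', i ≠ j → M (i, j, l') = M' (i, j, l') := fun i j l' hij => by
    simp only [hM, hM', extend, truncate]
    rw [if_neg fun H => hij (sub_eq_zero.1 H.1).symm]
  have hdiag : ∀ i l', M (i, i, l') = x (0, l') ^ (Nat.card 𝓀[K] ^ tau n k i) := fun i l' => by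
    simp only [hM, extend, sub_self]
  have hdiag' : ∀ i l', M' (i, i, l') =
      if l ≤ l' then 0 else x (0, l') ^ (Nat.card 𝓀[K] ^ tau n k i) := fun i l' => by
    simp only [hM', extend, truncate, sub_self, true_and]
    split_ifs
    · exact zero_pow (pow_pos (ϖ.isBase.q_pos) _).ne'
    · rfl
  let u : Fin n → OWitt ϖ A := fun i => entry ϖ M i i - entry ϖ M' i i
  have hu : ∀ i, u i ∈ fil ϖ A (l + 1) := fun i => by
    refine sub_mem_fil_iff.2 fun m hm => ?_
    simp only [entry, if_true]
    split_ifs with h0 h1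
    · rfl
    · rw [hdiag, hdiag', if_neg]
      rw [not_le, Fin.lt_def]
      change m - 1 < (l : ℕ)
      omega
    · rfl
  have hucoeff : ∀ i, (u i).coeff (l + 1) = x (0, l) ^ (Nat.card 𝓀[K] ^ tau n k i) := fun i => by
    have h1 := (add_coeff_of_mem_fil (entry ϖ M' i i) (hu i)).2
    rw [add_sub_cancel] at h1
    have h2 : ∀ N : Index n h → A, (entry ϖ N i i).coeff (l + 1) = N (i, i, l) := fun N => by
      simp [entry]
    rw [h2, h2, hdiag, hdiag', if_pos le_rfl, zero_add] at h1
    exact h1.symm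
  have hmat : stdMatrix ϖ M = stdMatrix ϖ M' + Matrix.diagonal u := by
    refine Matrix.ext fun i j => ?_
    rw [Matrix.add_apply, Matrix.diagonal_apply]
    split_ifs with hij
    · subst hij
      rw [stdMatrix_self, stdMatrix_self, add_sub_cancel]
    · have : entry ϖ M i j = entry ϖ M' i j := by
        simp only [entry, if_neg hij, hoff i j _ hij]
      rw [add_zero, stdMatrix, stdMatrix, Matrix.of_apply, Matrix.of_apply, this]
  have hdet := Matrix.det_add_diagonal_sub_mem (I := fil ϖ A 1) (J := fil ϖ A (l + 1))
    (J' := fil ϖ A (l + 1 + 1)) (fun a ha b hb => mul_mem_fil_succ ha hb)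
    (fil_anti (Nat.le_add_left 1 l)) (M := stdMatrix ϖ M') (u := u)
    (fun i => by rw [stdMatrix_self]; exact entry_self_sub_one_mem ϖ M' i)
    (fun i j hij => stdMatrix_mem_of_lt ϖ M' hij) hu
  rw [← hmat, sub_sub] at hdet
  rw [detCoeff, detCoeff, ← hM, ← hM', sub_mem_fil_iff.1 hdet _ (Nat.lt_succ_self _),
    (add_coeff_of_mem_fil _ ((fil ϖ A (l + 1)).sum_mem fun i _ => hu i)).2,
    sum_coeff_of_mem_fil _ fun i _ => hu i]
  simp only [hucoeff]
  rw [sum_tau hkn fun j => x (0, l) ^ (Nat.card 𝓀[K] ^ j)]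

/-- The `q`-th power is additive on `A`, so for `T = ∑ x ^ (q ^ j)` over `j < n` the difference `T ^
q - T` telescopes to `x ^ (q ^ n) - x`. -/
theorem detCoeff_pow_sub (hkn : k.Coprime n) (x : Fin n × Fin (h - 1) → A) (l : Fin (h - 1)) :
    detCoeff k ϖ x l ^ Nat.card 𝓀[K] - detCoeff k ϖ x l =
      x (0, l) ^ (Nat.card 𝓀[K] ^ n) - x (0, l) +
        (detCoeff k ϖ (truncate l x) l ^ Nat.card 𝓀[K] - detCoeff k ϖ (truncate l x) l) := by
  have := Fintype.ofFinite 𝓀[K]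
  have hF : ∀ a : A, a ^ Nat.card 𝓀[K] = FiniteField.frobeniusAlgHom 𝓀[K] A a := fun a => by
    rw [Nat.card_eq_fintype_card]; rfl
  have hsum : (∑ j ∈ Finset.range n, x (0, l) ^ (Nat.card 𝓀[K] ^ j)) ^ Nat.card 𝓀[K] +
      x (0, l) = x (0, l) ^ (Nat.card 𝓀[K] ^ n) +
        ∑ j ∈ Finset.range n, x (0, l) ^ (Nat.card 𝓀[K] ^ j) := by
    rw [hF, map_sum]
    simp only [← hF, ← pow_mul, ← pow_succ]
    rw [add_comm (x (0, l) ^ (Nat.card 𝓀[K] ^ n)), ← Finset.sum_range_succ,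
      Finset.sum_range_succ', pow_zero, pow_one]
  have hadd : ∀ a b : A, (a + b) ^ Nat.card 𝓀[K] = a ^ Nat.card 𝓀[K] + b ^ Nat.card 𝓀[K] :=
    fun a b => by simp only [hF, map_add]
  rw [detCoeff_eq ϖ hkn x l, hadd]
  linear_combination hsum

end points

/-! ### The coordinate ring and its functor of points. -/

section ring

variable (𝕜 : Type v) [Field 𝕜] [Algebra 𝓀[K] 𝕜]

/-- The constant terms of the equations of `X_h`, seen as equations for the coordinates of the first
diagonal entry. -/
noncomputable def constTerm (n : ℕ) [NeZero n] (k h : ℕ) (l : Fin (h - 1)) :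
    MvPolynomial (Fin n × Fin (h - 1)) 𝕜 :=
  detCoeff k ϖ (truncate l MvPolynomial.X) l ^ Nat.card 𝓀[K] -
    detCoeff k ϖ (truncate l MvPolynomial.X) l

/-- The coordinate ring of `X_h`. -/
abbrev CoordRing (n : ℕ) [NeZero n] (k h : ℕ) : Type v :=
  Tower.Ring (fun l : Fin (h - 1) => ((0, l) : Fin n × Fin (h - 1))) (Nat.card 𝓀[K] ^ n)
    (constTerm ϖ 𝕜 n k h)

/-- The truncated tuple of variables has entries in the subalgebra generated by the allowed
variables. By naturality for its inclusion, the determinant coordinates can be computed inside it.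
-/
theorem constTerm_mem (l : Fin (h - 1)) : constTerm ϖ 𝕜 n k h l ∈ MvPolynomial.supported 𝕜
    (Tower.free (fun l : Fin (h - 1) => ((0, l) : Fin n × Fin (h - 1))) l) := by
  classical
  set s := Tower.free (fun l : Fin (h - 1) => ((0, l) : Fin n × Fin (h - 1))) l with hs
  have h1 : ∀ p, truncate l (MvPolynomial.X : _ → MvPolynomial (Fin n × Fin (h - 1)) 𝕜) p ∈
      MvPolynomial.supported 𝕜 s := fun p => by
    rw [truncate]
    split_ifs with hp
    · exact zero_mem _
    · refine Algebra.subset_adjoin ⟨p, fun l' hl' => ?_, rfl⟩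
      subst hl'
      simpa using hp
  let y : Fin n × Fin (h - 1) → MvPolynomial.supported 𝕜 s := fun p => ⟨_, h1 p⟩
  have h2 : detCoeff k ϖ (truncate l (MvPolynomial.X : _ → MvPolynomial _ 𝕜)) l ∈
      MvPolynomial.supported 𝕜 s := by
    have h3 := map_detCoeff ϖ (k := k)
      ((MvPolynomial.supported 𝕜 s).val.restrictScalars 𝓀[K]) y l
    change _ = detCoeff k ϖ (truncate l (MvPolynomial.X : _ → MvPolynomial _ 𝕜)) l at h3
    rw [← h3]
    exact Subtype.property _
  exact sub_mem (pow_mem h2 _) h2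

variable {𝕜} {A : Type w} [CommRing A] [Algebra 𝕜 A]

/-- The first row of the point of `X_h` that belongs to a homomorphism from the coordinate ring. -/
noncomputable def firstRow (f : CoordRing ϖ 𝕜 n k h →ₐ[𝕜] A) : Fin n × Fin (h - 1) → A :=
  fun p => f (Ideal.Quotient.mk _ (MvPolynomial.X p))

theorem aeval_firstRow (f : CoordRing ϖ 𝕜 n k h →ₐ[𝕜] A)
    (g : MvPolynomial (Fin n × Fin (h - 1)) 𝕜) :
    MvPolynomial.aeval (firstRow ϖ f) g = f (Ideal.Quotient.mk _ g) :=
  (DFunLike.congr_fun (MvPolynomial.aeval_unique (f.comp (Ideal.Quotient.mkₐ 𝕜 _))) g).symm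

theorem firstRow_injective :
    Function.Injective (firstRow ϖ : (CoordRing ϖ 𝕜 n k h →ₐ[𝕜] A) → _) := by
  intro f f' H
  refine AlgHom.ext fun s => ?_
  obtain ⟨g, rfl⟩ := Ideal.Quotient.mk_surjective s
  rw [← aeval_firstRow, ← aeval_firstRow, H]

variable [Algebra 𝓀[K] A] [IsScalarTower 𝓀[K] 𝕜 A]

/-- On the tuple of variables, the relation of the tower is `d_l ^ q - d_l` by `detCoeff_pow_sub`;
naturality carries this to `x`. -/
theorem aeval_rel (hkn : k.Coprime n) (x : Fin n × Fin (h - 1) → A) (l : Fin (h - 1)) :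
    MvPolynomial.aeval x (Tower.rel (fun l : Fin (h - 1) => ((0, l) : Fin n × Fin (h - 1)))
      (Nat.card 𝓀[K] ^ n) (constTerm ϖ 𝕜 n k h) l) =
      detCoeff k ϖ x l ^ Nat.card 𝓀[K] - detCoeff k ϖ x l := by
  rw [Tower.rel, constTerm, ← detCoeff_pow_sub ϖ hkn, map_sub, map_pow]
  have := map_detCoeff ϖ (k := k) ((MvPolynomial.aeval x :
    MvPolynomial (Fin n × Fin (h - 1)) 𝕜 →ₐ[𝕜] A).restrictScalars 𝓀[K]) MvPolynomial.X l
  simp only [AlgHom.restrictScalars_apply, MvPolynomial.aeval_X] at this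
  rw [this]

theorem extend_firstRow_mem (hkn : k.Coprime n) (f : CoordRing ϖ 𝕜 n k h →ₐ[𝕜] A) :
    extend k K (firstRow ϖ f) ∈ points ϖ n k h A := by
  rw [mem_points_iff ϖ hkn]
  simp only [extend_zero]
  refine ⟨trivial, fun l => sub_eq_zero.1 ?_⟩
  rw [← aeval_rel ϖ (𝕜 := 𝕜) hkn, aeval_firstRow,
    Ideal.Quotient.eq_zero_iff_mem.2 (Ideal.subset_span (Set.mem_range_self l)), map_zero]

/-- The points of `X_h` are the homomorphisms from its coordinate ring. -/
noncomputable def homEquivPoints (hkn : k.Coprime n) :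
    (CoordRing ϖ 𝕜 n k h →ₐ[𝕜] A) ≃ points ϖ n k h A :=
  Equiv.ofBijective (fun f => ⟨extend k K (firstRow ϖ f), extend_firstRow_mem ϖ hkn f⟩) (by
    constructor
    · intro f f' H
      refine firstRow_injective ϖ (funext fun p => ?_)
      have := congrFun (congrArg Subtype.val H) (0, p.1, p.2)
      simpa only [extend_zero] using this
    · rintro ⟨M, hM⟩
      obtain ⟨h1, h2⟩ := (mem_points_iff ϖ hkn).1 hM
      -- The first row of a point satisfies all relations, so evaluation at it factors through the
      -- coordinate ring.
      have h3 : Ideal.span (Set.range (Tower.rel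
          (fun l : Fin (h - 1) => ((0, l) : Fin n × Fin (h - 1))) (Nat.card 𝓀[K] ^ n)
            (constTerm ϖ 𝕜 n k h))) ≤
          RingHom.ker (MvPolynomial.aeval (R := 𝕜) fun p => M (0, p.1, p.2)) := by
        rw [Ideal.span_le]
        rintro _ ⟨l, rfl⟩
        exact (aeval_rel ϖ hkn _ l).trans (sub_eq_zero.2 (h2 l))
      refine ⟨Ideal.Quotient.liftₐ _ (MvPolynomial.aeval fun p => M (0, p.1, p.2))
        fun g hg => h3 hg, Subtype.ext ?_⟩
      refine Eq.trans (congrArg (extend k K) (funext fun p => ?_)) h1.symm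
      exact MvPolynomial.aeval_X _ _)

end ring

end Xh

/-! ### Representability and conclusion. -/

/-- The functor of points of an affine scheme over a field. -/
noncomputable def pointsFunctorAlgSpecObj {𝕜 : Type v} [Field 𝕜] (S : CommAlgCat.{v} 𝕜)
    (F : CommAlgCat.{v} 𝕜 ⥤ Type v) (e : ∀ A : CommAlgCat.{v} 𝕜, (S →ₐ[𝕜] A) ≃ F.obj A)
    (he : ∀ {A B : CommAlgCat.{v} 𝕜} (f : A ⟶ B) (g : S →ₐ[𝕜] A),
      e B (f.hom.comp g) = F.map f (e A g)) :
    pointsFunctor ((algSpec (CommRingCat.of 𝕜)).obj (Opposite.op S)) ≅ F :=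
  let E := algSpec.fullyFaithful (R := CommRingCat.of 𝕜)
  let ε : ∀ A : CommAlgCat.{v} 𝕜, ((algSpec (CommRingCat.of 𝕜)).obj (Opposite.op A) ⟶
      (algSpec (CommRingCat.of 𝕜)).obj (Opposite.op S)) ≃ F.obj A := fun A =>
    E.homEquiv.symm.trans ((opEquiv _ _).trans (ConcreteCategory.homEquiv.trans (e A)))
  have hε : ∀ (A : CommAlgCat.{v} 𝕜) (g : Opposite.op A ⟶ Opposite.op S),
      ε A ((algSpec (CommRingCat.of 𝕜)).map g) = e A g.unop.hom := fun A g =>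
    congrArg (fun t : Opposite.op A ⟶ Opposite.op S => e A t.unop.hom) (E.preimage_map g)
  NatIso.ofComponents (fun A => Equiv.toIso (ε A)) (by
    intro A B f
    ext g
    -- By full faithfulness, every morphism of spectra over `𝕜` comes from an algebra homomorphism,
    -- so naturality is checked on those.
    obtain ⟨g, rfl⟩ := E.homEquiv.surjective g
    change ε B ((algSpec (CommRingCat.of 𝕜)).map f.op ≫ (algSpec (CommRingCat.of 𝕜)).map g) =
      F.map f (ε A ((algSpec (CommRingCat.of 𝕜)).map g))
    rw [← Functor.map_comp, hε, hε]
    exact he f g.unop.hom)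

theorem propositionp (K : Type u) [Field K] [ValuativeRel K] [TopologicalSpace K]
    [IsNonarchimedeanLocalField K] (ϖ : Uniformizer K)
    (n k h : ℕ) [NeZero n] (hk : 1 ≤ k) (hkn : k.Coprime n) (hh : 1 ≤ h)
    (𝕜 : Type v) [Field 𝕜] [Algebra 𝓀[K] 𝕜] (h𝕜 : Module.finrank 𝓀[K] 𝕜 = n) :
    ∃ X : Over (Spec (CommRingCat.of 𝕜)),
      Nonempty (pointsFunctor X ≅ Xh.functor ϖ n k h 𝕜) ∧
      IsAffine X.left ∧
      SmoothOfRelativeDimension ((n - 1) * (h - 1)) X.hom ∧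
      topologicalKrullDim X.left = (((n - 1) * (h - 1) : ℕ) : WithBot ℕ∞) := by
  have ha : Function.Injective fun l : Fin (h - 1) => ((0, l) : Fin n × Fin (h - 1)) :=
    fun l l' hl => congrArg Prod.snd hl
  have hn : n ≠ 0 := NeZero.ne n
  have hN : 2 ≤ Nat.card 𝓀[K] ^ n :=
    (Finite.one_lt_card (α := 𝓀[K])).trans_le (Nat.le_self_pow hn _)
  have hN' : ((Nat.card 𝓀[K] ^ n : ℕ) : 𝕜) = 0 := by
    have := Fintype.ofFinite 𝓀[K]
    rw [Nat.cast_pow, ← map_natCast (algebraMap 𝓀[K] 𝕜), Nat.card_eq_fintype_card,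
      FiniteField.cast_card_eq_zero, map_zero, zero_pow hn]
  -- There are `n(h-1)` variables and `h-1` relations.
  have hcard : Nat.card (Fin n × Fin (h - 1)) - (h - 1) = (n - 1) * (h - 1) := by
    rw [Nat.card_prod, Nat.card_eq_fintype_card, Nat.card_eq_fintype_card, Fintype.card_fin,
      Fintype.card_fin, Nat.sub_mul, one_mul]
  have hdim := Tower.ringKrullDim_eq ha hN (Xh.constTerm_mem ϖ 𝕜 (k := k))
  have hsmooth := Tower.isStandardSmooth ha hN' (Xh.constTerm_mem ϖ 𝕜 (k := k))
  rw [hcard] at hdim hsmooth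
  refine ⟨(algSpec (CommRingCat.of 𝕜)).obj
    (Opposite.op (CommAlgCat.of 𝕜 (Xh.CoordRing ϖ 𝕜 n k h))), ⟨?_⟩, ?_, ?_, ?_⟩
  · refine pointsFunctorAlgSpecObj _ _ (fun A => ?_) ?_
    · let _ := Algebra.compHom A (algebraMap 𝓀[K] 𝕜)
      have : IsScalarTower 𝓀[K] 𝕜 A := IsScalarTower.of_algebraMap_eq fun _ => rfl
      exact Xh.homEquivPoints ϖ hkn
    · intro A B f g
      refine Subtype.ext (funext fun p => ?_)
      exact (map_pow f.hom _ _).symm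
  · exact inferInstanceAs (IsAffine (Spec _))
  · refine (HasRingHomProperty.Spec_iff (P := @SmoothOfRelativeDimension _)
      (φ := CommRingCat.ofHom (algebraMap 𝕜 (Xh.CoordRing ϖ 𝕜 n k h)))).2 ?_
    -- Smoothness of schemes asks for standard smoothness only locally; here one global presentation
    -- serves.
    refine RingHom.locally_of RingHom.isStandardSmoothOfRelativeDimension_respectsIso _ ?_
    exact (RingHom.isStandardSmoothOfRelativeDimension_algebraMap _).2 hsmooth
  · exact (PrimeSpectrum.topologicalKrullDim_eq_ringKrullDim
      (R := Xh.CoordRing ϖ 𝕜 n k h)).trans hdim
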